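/- Let $d\ge 3$. The half-$d$-cube $\frac12\gamma_d$ is the convex hull of those vertices of the cube $[0,1]^d$ that have an even number of coordinates equal to $1$. Its faces (including $\emptyset$ and the polytope itself), ordered by inclusion, form a $(d-1)$-dimensional complex: a finite ranked partially ordered set with lowest and greatest element, all of whose maximal chains have the form $x_0<x_1<\dots<x_d<x_{d+1}$, and in which there are exactly two elements strictly between $x\le y$ whenever the rank of $y$ is the rank of $x$ plus $2$. A flag is a maximal chain; for $1\le i\le d$ the operator $\sigma_i$ replaces the element of rank $i$ of a flag by the unique other element that again gives a flag, and $T=\sigma_d\sigma_{d-1}\cdots\sigma_1$ ($\sigma_1$ is applied first). A zigzag is a circuit $Z=(f_1,\dots,f_l)$ of $T$ on the set of flags, with $f_{j+1}=T(f_j)$, and $l$ is its length. The reverse $f^t$ of a flag $f$ is the flag whose element of rank $i$, $1\le i\le d$, is the element of rank $i$ of $T^{d-i}(f)$, and $Z^t=(f_l^t,\dots,f_1^t)$. The signature of $Z$ is the pair $(n_I,n_{II})$ of the numbers of its self-intersections of type I and of type II, which are given by the flags $f$ of $Z$ with $\sigma_1(f)\in Z$, respectively $\sigma_1(f)\in Z^t$,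 each self-intersection being given by two flags of $Z$. The symmetry group is the group of automorphisms of the partially ordered set of faces. Then: (i) The half-$d$-cube has exactly $d!\,2^{d-1}(d-2)$ flags. Under the symmetry group they form one orbit if $d=3$ or $d=4$, and exactly $d-2$ orbits if $d\ge 5$. (ii) $T$ induces a permutation of the set of orbits of flags, and this permutation is a single cycle on all the orbits; consequently every zigzag contains flags of every orbit. Moreover, the half-$d$-cube is $z$-uniform: all its zigzags have the same length and the same signature. -/

import Mathlib

/-! Complexes, flags, the translation operator, zigzags, and the half-cube. -/

namespace Zigzag

section Complexes

variable {α : Type*} [PartialOrder α]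

/-- `α` is an `n`-dimensional complex: a finite ranked poset with a lowest and a greatest element,
all of whose maximal chains `0 < x₁ < ⋯ < x_{n+1} < 1` have length `n + 2` (that is, `n + 3`
elements), and with exactly two elements strictly between `x ≤ y` whenever the ranks of
`x` and `y` differ by two. The rank of an element is its `Order.height`, its dimension is the
rank minus one. -/
structure IsComplex (n : ℕ) (α : Type*) [PartialOrder α] : Prop where
  finite : Finite α
  exists_bot : ∃ x : α, IsBot x
  exists_top : ∃ x : α, IsTop x
  ranked : ∀ x y : α, x ⋖ y → Order.height y = Order.height x + 1
  flag_length : ∀ f : Flag α, (f : Set α).ncard = n + 3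
  diamond : ∀ x y : α, x ≤ y → Order.height y = Order.height x + 2 → (Set.Ioo x y).ncard = 2

/-- The flags `f` and `g` differ, and they differ only in their element of rank `i`. -/
def FlagAdj (i : ℕ) (f g : Flag α) : Prop :=
  f ≠ g ∧ ∀ x : α, Order.height x ≠ (i : ℕ∞) → (x ∈ f ↔ x ∈ g)

open Classical in
/-- The operator `σ_i`: it replaces the element of rank `i` of a flag by the other possible one.
In an `n`-dimensional complex, for `1 ≤ i ≤ n + 1`, there is exactly one flag `g` with
`FlagAdj i f g`, and `sigma i f` is this flag. -/
noncomputable def sigma (i : ℕ) (f : Flag α) : Flag α :=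
  if h : ∃ g, FlagAdj i f g then h.choose else f

/-- `translation k = σ_k ∘ ⋯ ∘ σ_2 ∘ σ_1`. The translation operator `T` of an `n`-dimensional
complex is `translation (n + 1)`. -/
noncomputable def translation : ℕ → Flag α → Flag α
  | 0, f => f
  | k + 1, f => sigma (k + 1) (translation k f)

/-- The reverse `fᵗ` of a flag `f` of an `n`-dimensional complex is `reverse (n + 1) f`.
Here `reverse m = translation 1 ∘ translation 2 ∘ ⋯ ∘ translation (m - 1)`. In the triangular
array `(x_{i,j})` with `x_{i,1} = x_i`, in which `x_{i,j+1}` is the element of rank `i` other than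
`x_{i,j}` between `x_{i-1,j+1}` and `x_{i+1,j}`, `translation (m - 1)` passes from
`x_{1,1}, …, x_{m,1}` to `x_{1,2}, …, x_{m-1,2}, x_{m,1}`, then `translation (m - 2)` passes to
`x_{1,3}, …, x_{m-2,3}, x_{m-1,2}, x_{m,1}`, and so on until `x_{1,m}, x_{2,m-1}, …, x_{m,1}`. -/
noncomputable def reverse : ℕ → Flag α → Flag α
  | 0, f => f
  | k + 1, f => reverse k (translation k f)

/-- The zigzag through the flag `f` of an `n`-dimensional complex, as a set of flags: the circuit
`f, T f, T² f, …` of the permutation `T`. -/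
def zigzag (n : ℕ) (f : Flag α) : Set (Flag α) :=
  Set.range fun k : ℕ => (translation (n + 1))^[k] f

/-- The set `Z` of flags is a zigzag of the `n`-dimensional complex `α`. -/
def IsZigzag (n : ℕ) (Z : Set (Flag α)) : Prop :=
  ∃ f, Z = zigzag n f

/-- The reverse `Zᵗ` of a zigzag `Z`. -/
def reverseZigzag (n : ℕ) (Z : Set (Flag α)) : Set (Flag α) :=
  reverse (n + 1) '' Z

/-- The signature `(n_I, n_II)` of a zigzag `Z`: the numbers of its self-intersections of type I,
given by the flags `f` of `Z` with `σ_1 f` in `Z`, and of type II, given by the flags `f` of `Z`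
with `σ_1 f` in `Zᵗ`. Each self-intersection is passed twice by the zigzag, so it is given by two of
its flags (thus `2 (n_I + n_II)` is its contribution to the length of `Z`). -/
noncomputable def signature (n : ℕ) (Z : Set (Flag α)) : ℕ × ℕ :=
  ({f ∈ Z | sigma 1 f ∈ Z}.ncard / 2, {f ∈ Z | sigma 1 f ∈ reverseZigzag n Z}.ncard / 2)

/-- An `n`-dimensional complex is `z`-uniform if all its zigzags have the same length and the same
signature. -/
def IsZUniform (n : ℕ) (α : Type*) [PartialOrder α] : Prop :=
  ∀ Z Z' : Set (Flag α), IsZigzag n Z → IsZigzag n Z' →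
    Z.ncard = Z'.ncard ∧ signature n Z = signature n Z'

/-- The set of orbits of flags under the symmetry group, the group of order automorphisms. -/
abbrev FlagOrbit (α : Type*) [PartialOrder α] : Type _ :=
  MulAction.orbitRel.Quotient (α ≃o α) (Flag α)

/-- The orbit of a flag. -/
def flagOrbit (f : Flag α) : FlagOrbit α :=
  Quotient.mk _ f

end Complexes

/-- The half-`d`-cube `½γ_d`: the convex hull in `ℝ^d` of the vertices of the cube `[0,1]^d` that
have an even number of coordinates equal to one. -/
def halfCube (d : ℕ) : Set (Fin d → ℝ) :=
  convexHull ℝ {v | ∃ S : Finset (Fin d), Even S.card ∧ v = fun i => if i ∈ S then 1 else 0}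

/-- The faces of the half-`d`-cube (the empty face, the sets where a linear functional attains its
maximum over the polytope, among them the polytope itself), ordered by inclusion. -/
abbrev HalfCubeFace (d : ℕ) : Type :=
  {F : Set (Fin d → ℝ) // IsExposed ℝ (halfCube d) F}

end Zigzag

/-! The faces of the half-cube are classified by their vertices, which determine them by the
Krein-Milman theorem (`le_iff_verts_subset`). A linear functional on the vertices of the cube is, up
to sign and a constant, a weighted distance to a vertex `w` of the cube, so a nonempty face consists
of the even vertices nearest to some `w`. If some weight vanishes, this is a half-cube in the
directions of weight zero (`subcubeFace`); if `w` is even and no weight vanishes, it is the vertex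
`w`; and if `w` is odd and no weight vanishes, it is the simplex on those neighbours of `w` in the
directions of least weight (`simplexFace`). See `eq_simplexFace_or_subcubeFace`. The faces below a
simplex or a half-cube are then explicit, which yields the heights and the diamond property.

A flag consists of simplices at one odd vertex `w` up to some height `k` with `3 ≤ k ≤ d`, and of
half-cubes above; together with the order `π` in which the coordinates are added, this describes
the flag uniquely (`exists_flagData`, `flagData_ext`). Counting the triples `(w, π, k)` gives the
number of flags. The even signed permutations of the coordinates act transitively on the flags
with given `k`, the simplex rank of the flag. For `d ≥ 5` automorphisms preserve the simplex rank,
since a simplex facet is neighbourly and a half-cube facet is not; for `d = 4` the half-cube is a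
cross polytope, and a further reflection exchanges the two ranks.

The operator `σ_i` changes the simplex rank only for `i = k`, to `k - 1` unless `k = 3`, and for
`i = k + 1`, to `k + 1`. Hence `T = σ_d ⋯ σ_1` maps the rank `k ≥ 4` to `k - 1`: first `σ_k` lowers
it, and the later operators leave it alone. It maps the rank `3` to `d`, since each of
`σ_4, …, σ_d` raises the rank by one. So the ranks are permuted in a single cycle, and the powers of
`T` and the automorphisms together act transitively on the flags. As automorphisms commute with
all `σ_i`, any two zigzags are images of each other under automorphisms
(`IsComplex.isZUniform`), and the orbits form a single cycle of `T`
(`IsComplex.exists_perm_isCycleOn`). -/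

namespace Zigzag

open scoped symmDiff

/-! ### Flags of complexes and the action of automorphisms on them -/

section Complexes

variable {α : Type*} [PartialOrder α] {n : ℕ}

open Order

lemma height_lt_top [Finite α] (x : α) : height x < ⊤ := by
  have : Fintype α := Fintype.ofFinite α
  have h : height x ≤ (Fintype.card α : ℕ∞) := by
    refine height_le fun p _ => ?_
    exact_mod_cast p.length_lt_card.le
  exact h.trans_lt (ENat.natCast_lt_top _)

lemma height_lt_height [Finite α] {x y : α} (h : x < y) : height x < height y :=
  height_strictMono h (height_lt_top x)

lemma eq_of_mem_flag_of_height_eq [Finite α] (f : Flag α) {x y : α} (hx : x ∈ f) (hy : y ∈ f)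
    (h : height x = height y) : x = y := by
  rcases f.le_or_le hx hy with h' | h'
  · exact h'.eq_of_not_lt fun hlt => (height_lt_height hlt).ne h
  · exact (h'.eq_of_not_lt fun hlt => (height_lt_height hlt).ne' h).symm

lemma le_of_mem_flag_of_height_le [Finite α] (f : Flag α) {x y : α} (hx : x ∈ f) (hy : y ∈ f)
    (h : height x ≤ height y) : x ≤ y := by
  rcases f.le_or_le hx hy with h' | h'
  · exact h'
  · exact (h'.eq_of_not_lt fun hlt => (height_lt_height hlt).not_ge h).ge

lemma lt_of_mem_flag_of_height_lt [Finite α] (f : Flag α) {x y : α} (hx : x ∈ f) (hy : y ∈ f)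
    (h : height x < height y) : x < y :=
  (le_of_mem_flag_of_height_le f hx hy h.le).lt_of_ne fun e => h.ne (by rw [e])

/-- A chain that meets every height is a maximal chain. -/
lemma isMaxChain_of_forall_height [Finite α] {c : Set α} (hc : IsChain (· ≤ ·) c)
    (h : ∀ x : α, ∃ y ∈ c, height y = height x) : IsMaxChain (· ≤ ·) c := by
  refine ⟨hc, fun t ht hct => hct.antisymm fun x hx => ?_⟩
  obtain ⟨y, hy, hxy⟩ := h x
  have : x = y := by
    rcases ht.total hx (hct hy) with h' | h'
    · exact h'.eq_of_not_lt fun hlt => (height_lt_height hlt).ne' hxy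
    · exact (h'.eq_of_not_lt fun hlt => (height_lt_height hlt).ne hxy).symm
  exact this ▸ hy

lemma mem_smul_flag {e : α ≃o α} {f : Flag α} {x : α} : x ∈ e • f ↔ e.symm x ∈ f := by
  rw [← SetLike.mem_coe, Flag.coe_smul]
  constructor
  · rintro ⟨y, hy, rfl⟩
    simpa using hy
  · intro h
    exact ⟨e.symm x, h, by simp⟩

lemma smul_mem_smul_flag {e : α ≃o α} {f : Flag α} {x : α} : e x ∈ e • f ↔ x ∈ f := by
  simp [mem_smul_flag]

lemma FlagAdj.symm {i : ℕ} {f g : Flag α} (h : FlagAdj i f g) : FlagAdj i g f :=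
  ⟨h.1.symm, fun x hx => (h.2 x hx).symm⟩

lemma FlagAdj.smul {i : ℕ} {f g : Flag α} (h : FlagAdj i f g) (e : α ≃o α) :
    FlagAdj i (e • f) (e • g) := by
  refine ⟨fun h' => h.1 (smul_left_cancel e h'), fun x hx => ?_⟩
  rw [mem_smul_flag, mem_smul_flag]
  exact h.2 _ (by rwa [height_orderIso])

/-- Two flags that agree off the height `i` and share an element of height `i` are equal. -/
lemma flag_eq_of_agree [Finite α] {i : ℕ} {f g : Flag α}
    (h : ∀ x : α, height x ≠ (i : ℕ∞) → (x ∈ f ↔ x ∈ g)) {z : α} (hf : z ∈ f) (hg : z ∈ g)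
    (hz : height z = i) : f = g := by
  refine SetLike.ext fun x => ?_
  by_cases hx : height x = i
  · constructor
    · intro hxf
      rwa [eq_of_mem_flag_of_height_eq f hxf hf (hx.trans hz.symm)]
    · intro hxg
      rwa [eq_of_mem_flag_of_height_eq g hxg hg (hx.trans hz.symm)]
  · exact h x hx

lemma flagOrbit_eq_iff {f g : Flag α} :
    flagOrbit f = flagOrbit g ↔ ∃ e : α ≃o α, f = e • g := by
  rw [flagOrbit, flagOrbit, Quotient.eq, MulAction.orbitRel_apply, MulAction.mem_orbit_iff]
  exact exists_congr fun _ => eq_comm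

namespace IsComplex

variable (hα : IsComplex n α)
include hα

lemma height_le (x : α) : height x ≤ ((n + 2 : ℕ) : ℕ∞) := by
  have := hα.finite
  refine Order.height_le fun p _ => ?_
  obtain ⟨f, hf⟩ := (p.strictMono.monotone.isChain_range).exists_subset_flag
  have h := Set.ncard_le_ncard hf (Set.toFinite _)
  rw [hα.flag_length, ← Set.image_univ, Set.ncard_image_of_injective _ p.strictMono.injective,
    Set.ncard_univ, Nat.card_fin] at h
  exact_mod_cast (by omega : p.length ≤ n + 2)

lemma exists_mem_flag (f : Flag α) {i : ℕ} (hi : i ≤ n + 2) : ∃ x ∈ f, height x = i := by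
  have := hα.finite
  have hcoe (x : α) : ((height x).toNat : ℕ∞) = height x :=
    ENat.natCast_toNat (height_lt_top x).ne
  have hinj : Set.InjOn (fun x : α => (height x).toNat) (f : Set α) := fun x hx y hy hxy =>
    eq_of_mem_flag_of_height_eq f hx hy (by rw [← hcoe, ← hcoe y]; exact congrArg _ hxy)
  have hsub : (fun x : α => (height x).toNat) '' (f : Set α) ⊆ Set.Iic (n + 2) := by
    rintro _ ⟨x, -, rfl⟩
    have := hα.height_le x
    rw [← hcoe] at this
    exact_mod_cast this
  have heq := Set.eq_of_subset_of_ncard_le hsub (by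
    rw [hinj.ncard_image, hα.flag_length]
    simp [Set.ncard_eq_toFinset_card']) (Set.toFinite _)
  obtain ⟨x, hx, hxi⟩ := heq.ge (Set.mem_Iic.2 hi)
  exact ⟨x, hx, by rw [← hcoe, ← hxi]⟩

lemma exists_flagAdj (f : Flag α) {i : ℕ} (hi : 1 ≤ i) (hi' : i ≤ n + 1) :
    ∃ g, FlagAdj i f g := by
  have := hα.finite
  obtain ⟨j, rfl⟩ : ∃ j, i = j + 1 := ⟨i - 1, by omega⟩
  obtain ⟨x, hx, hxi⟩ := hα.exists_mem_flag f (i := j) (by omega)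
  obtain ⟨z, hz, hzi⟩ := hα.exists_mem_flag f (i := j + 1) (by omega)
  obtain ⟨y, hy, hyi⟩ := hα.exists_mem_flag f (i := j + 2) (by omega)
  have hxz : x < z := lt_of_mem_flag_of_height_lt f hx hz (by
    rw [hxi, hzi]; exact_mod_cast Nat.lt_succ_self j)
  have hzy : z < y := lt_of_mem_flag_of_height_lt f hz hy (by
    rw [hzi, hyi]; exact_mod_cast Nat.lt_succ_self (j + 1))
  have hcard := hα.diamond x y (hxz.trans hzy).le (by rw [hxi, hyi]; norm_cast)
  obtain ⟨z', hz', hne⟩ := Set.exists_ne_of_one_lt_ncard (by omega : 1 < (Set.Ioo x y).ncard) z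
  have hz'i : height z' = (j + 1 : ℕ) := by
    have h1 := height_lt_height hz'.1
    have h2 := height_lt_height hz'.2
    rw [hxi] at h1
    rw [hyi] at h2
    obtain ⟨m, hm⟩ := ENat.ne_top_iff_exists.1 (height_lt_top z').ne
    rw [← hm] at h1 h2 ⊢
    norm_cast at h1 h2 ⊢
    omega
  have hcmp (u : α) (hu : u ∈ f) (hui : height u ≠ (j + 1 : ℕ)) : u ≤ x ∨ y ≤ u := by
    obtain ⟨m, hm⟩ := ENat.ne_top_iff_exists.1 (height_lt_top u).ne
    rw [← hm] at hui
    norm_cast at hui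
    rcases Nat.lt_or_gt_of_ne hui with h | h
    · refine .inl (le_of_mem_flag_of_height_le f hu hx ?_)
      rw [← hm, hxi]
      exact_mod_cast Nat.lt_succ_iff.1 h
    · refine .inr (le_of_mem_flag_of_height_le f hy hu ?_)
      rw [← hm, hyi]
      exact_mod_cast h
  have hchain : IsChain (· ≤ ·) (insert z' {u | u ∈ f ∧ height u ≠ (j + 1 : ℕ)}) := by
    refine IsChain.insert (fun u hu v hv _ => f.le_or_le hu.1 hv.1) fun u hu _ => ?_
    rcases hcmp u hu.1 hu.2 with h | h
    · exact .inr (h.trans hz'.1.le)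
    · exact .inl (hz'.2.le.trans h)
  have hmax := isMaxChain_of_forall_height hchain fun u => by
    by_cases hu : height u = (j + 1 : ℕ)
    · exact ⟨z', Set.mem_insert _ _, by rw [hz'i, hu]⟩
    · obtain ⟨m, hm⟩ := ENat.ne_top_iff_exists.1 (height_lt_top u).ne
      have := hα.height_le u
      rw [← hm] at this
      obtain ⟨v, hv, hvm⟩ := hα.exists_mem_flag f (i := m) (by exact_mod_cast this)
      have huv : height v = height u := hvm.trans hm
      exact ⟨v, Set.mem_insert_of_mem _ ⟨hv, by rwa [huv]⟩, huv⟩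
  refine ⟨Flag.ofIsMaxChain _ hmax, fun h => ?_, fun u hu => ?_⟩
  · have : z' ∈ f := by
      rw [h]
      exact Set.mem_insert _ _
    exact hne (eq_of_mem_flag_of_height_eq f this hz (hz'i.trans hzi.symm))
  · change u ∈ f ↔ u ∈ insert z' {u | u ∈ f ∧ height u ≠ (j + 1 : ℕ)}
    constructor
    · exact fun h => Set.mem_insert_of_mem _ ⟨h, hu⟩
    · rintro (rfl | h)
      · exact absurd hz'i hu
      · exact h.1

lemma flagAdj_unique {f g g' : Flag α} {i : ℕ} (hi : 1 ≤ i) (hi' : i ≤ n + 1)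
    (hg : FlagAdj i f g) (hg' : FlagAdj i f g') : g = g' := by
  have := hα.finite
  obtain ⟨j, rfl⟩ : ∃ j, i = j + 1 := ⟨i - 1, by omega⟩
  obtain ⟨x, hx, hxi⟩ := hα.exists_mem_flag f (i := j) (by omega)
  obtain ⟨y, hy, hyi⟩ := hα.exists_mem_flag f (i := j + 2) (by omega)
  have hx' : height x ≠ (j + 1 : ℕ) := by rw [hxi]; norm_cast; omega
  have hy' : height y ≠ (j + 1 : ℕ) := by rw [hyi]; norm_cast; omega
  have key (h : Flag α) (hxh : x ∈ h) (hyh : y ∈ h) :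
      ∃ z ∈ h, height z = (j + 1 : ℕ) ∧ z ∈ Set.Ioo x y := by
    obtain ⟨z, hz, hzi⟩ := hα.exists_mem_flag h (i := j + 1) (by omega)
    refine ⟨z, hz, hzi, lt_of_mem_flag_of_height_lt h hxh hz ?_,
      lt_of_mem_flag_of_height_lt h hz hyh ?_⟩
    · rw [hxi, hzi]; exact_mod_cast Nat.lt_succ_self j
    · rw [hzi, hyi]; exact_mod_cast Nat.lt_succ_self (j + 1)
  obtain ⟨z, hz, hzi, hzxy⟩ := key f hx hy
  obtain ⟨u, hu, hui, huxy⟩ := key g ((hg.2 x hx').1 hx) ((hg.2 y hy').1 hy)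
  obtain ⟨v, hv, hvi, hvxy⟩ := key g' ((hg'.2 x hx').1 hx) ((hg'.2 y hy').1 hy)
  have hcard := hα.diamond x y (hzxy.1.trans hzxy.2).le (by rw [hxi, hyi]; norm_cast)
  have hzu : z ≠ u := fun h => hg.1 (flag_eq_of_agree hg.2 hz (h ▸ hu) hzi)
  have hzv : z ≠ v := fun h => hg'.1 (flag_eq_of_agree hg'.2 hz (h ▸ hv) hzi)
  obtain ⟨a, b, -, hab⟩ := Set.ncard_eq_two.1 hcard
  have huv : u = v := by
    rw [hab] at hzxy huxy hvxy
    simp only [Set.mem_insert_iff, Set.mem_singleton_iff] at hzxy huxy hvxy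
    grind
  exact flag_eq_of_agree (fun w hw => (hg.2 w hw).symm.trans (hg'.2 w hw)) hu (huv ▸ hv) hui

lemma flagAdj_sigma (f : Flag α) {i : ℕ} (hi : 1 ≤ i) (hi' : i ≤ n + 1) :
    FlagAdj i f (sigma i f) := by
  have h := hα.exists_flagAdj f hi hi'
  rw [sigma, dif_pos h]
  exact h.choose_spec

lemma sigma_eq {f g : Flag α} {i : ℕ} (hi : 1 ≤ i) (hi' : i ≤ n + 1) (h : FlagAdj i f g) :
    sigma i f = g :=
  hα.flagAdj_unique hi hi' (hα.flagAdj_sigma f hi hi') h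

lemma sigma_involutive {i : ℕ} (hi : 1 ≤ i) (hi' : i ≤ n + 1) :
    Function.Involutive (sigma i : Flag α → Flag α) := fun f =>
  hα.sigma_eq hi hi' (hα.flagAdj_sigma f hi hi').symm

lemma sigma_smul (e : α ≃o α) (f : Flag α) {i : ℕ} (hi : 1 ≤ i) (hi' : i ≤ n + 1) :
    sigma i (e • f) = e • sigma i f :=
  hα.sigma_eq hi hi' ((hα.flagAdj_sigma f hi hi').smul e)

lemma translation_bijective {k : ℕ} (hk : k ≤ n + 1) :
    Function.Bijective (translation k : Flag α → Flag α) := by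
  induction k with
  | zero => exact Function.bijective_id
  | succ k ih =>
    exact (hα.sigma_involutive (by omega) hk).bijective.comp (ih (by omega))

lemma translation_smul (e : α ≃o α) (f : Flag α) {k : ℕ} (hk : k ≤ n + 1) :
    translation k (e • f) = e • translation k f := by
  induction k with
  | zero => rfl
  | succ k ih =>
    rw [translation, ih (by omega), hα.sigma_smul _ _ (by omega) hk, translation]

lemma iterate_translation_smul (e : α ≃o α) (f : Flag α) (m : ℕ) :
    (translation (n + 1))^[m] (e • f) = e • (translation (n + 1))^[m] f :=
  (Function.Semiconj.iterate_right (f := fun f : Flag α => e • f)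
    (fun f => (hα.translation_smul e f le_rfl).symm) m f).symm

lemma reverse_smul (e : α ≃o α) (f : Flag α) {k : ℕ} (hk : k ≤ n + 2) :
    reverse k (e • f) = e • reverse k f := by
  induction k generalizing f with
  | zero => rfl
  | succ k ih =>
    rw [reverse, hα.translation_smul _ _ (by omega), ih _ (by omega), reverse]

lemma zigzag_iterate (f : Flag α) (m : ℕ) :
    zigzag n ((translation (n + 1))^[m] f) = zigzag n f := by
  have := hα.finite
  have : Finite (Flag α) := Finite.of_injective (fun f : Flag α => (f : Set α))
    SetLike.coe_injective
  have hinj := ((hα.translation_bijective le_rfl).1).iterate m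
  have himage : zigzag n ((translation (n + 1))^[m] f) =
      (translation (n + 1))^[m] '' zigzag n f := by
    rw [zigzag, zigzag, ← Set.range_comp]
    congr 1
    funext k
    rw [Function.comp_apply, ← Function.iterate_add_apply, ← Function.iterate_add_apply,
      Nat.add_comm k m]
  refine Set.eq_of_subset_of_ncard_le ?_ ?_ (Set.toFinite _)
  · rintro _ ⟨k, rfl⟩
    exact ⟨k + m, Function.iterate_add_apply _ _ _ _⟩
  · rw [himage, Set.ncard_image_of_injective _ hinj]

lemma zigzag_smul (e : α ≃o α) (f : Flag α) :
    zigzag n (e • f) = (fun g : Flag α => e • g) '' zigzag n f := by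
  rw [zigzag, zigzag, ← Set.range_comp]
  congr 1
  funext k
  exact hα.iterate_translation_smul e f k

lemma signature_image_smul (e : α ≃o α) (Z : Set (Flag α)) :
    signature n ((fun g : Flag α => e • g) '' Z) = signature n Z := by
  have hinj : Function.Injective (fun g : Flag α => e • g) := MulAction.injective e
  have hmem (g : Flag α) (Y : Set (Flag α)) :
      e • g ∈ (fun g : Flag α => e • g) '' Y ↔ g ∈ Y := hinj.mem_set_image
  have hrev : reverseZigzag n ((fun g : Flag α => e • g) '' Z) =
      (fun g : Flag α => e • g) '' reverseZigzag n Z := by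
    rw [reverseZigzag, reverseZigzag, Set.image_image, Set.image_image]
    exact Set.image_congr fun f _ => hα.reverse_smul e f (by omega)
  have key (Y : Set (Flag α)) : {f ∈ (fun g : Flag α => e • g) '' Z |
      sigma 1 f ∈ (fun g : Flag α => e • g) '' Y} =
      (fun g : Flag α => e • g) '' {f ∈ Z | sigma 1 f ∈ Y} := by
    ext f
    constructor
    · rintro ⟨⟨g, hg, rfl⟩, hf⟩
      refine ⟨g, ⟨hg, ?_⟩, rfl⟩
      rw [hα.sigma_smul e g le_rfl (by omega), hmem] at hf
      exact hf
    · rintro ⟨g, ⟨hg, hgY⟩, rfl⟩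
      refine ⟨⟨g, hg, rfl⟩, ?_⟩
      rw [hα.sigma_smul e g le_rfl (by omega), hmem]
      exact hgY
  rw [signature, signature, hrev, key, key, Set.ncard_image_of_injective _ hinj,
    Set.ncard_image_of_injective _ hinj]

/-- If the powers of `T` and the automorphisms together act transitively on the flags, then any
two zigzags are images of each other under automorphisms. -/
theorem isZUniform (H : ∀ f g : Flag α, ∃ (m : ℕ) (e : α ≃o α),
    (translation (n + 1))^[m] f = e • g) : IsZUniform n α := by
  rintro _ _ ⟨f, rfl⟩ ⟨g, rfl⟩
  obtain ⟨m, e, h⟩ := H f g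
  rw [← hα.zigzag_iterate f m, h, hα.zigzag_smul, hα.signature_image_smul,
    Set.ncard_image_of_injective _ (MulAction.injective e)]
  exact ⟨rfl, rfl⟩

/-- If the powers of `T` and the automorphisms together act transitively on the flags, then the
permutation of the orbits of flags induced by `T` is a single cycle. -/
theorem exists_perm_isCycleOn (H : ∀ f g : Flag α, ∃ (m : ℕ) (e : α ≃o α),
    (translation (n + 1))^[m] f = e • g) :
    ∃ τ : Equiv.Perm (FlagOrbit α),
      (∀ f : Flag α, flagOrbit (translation (n + 1) f) = τ (flagOrbit f)) ∧
      τ.IsCycleOn Set.univ := by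
  let T := Equiv.ofBijective _ (hα.translation_bijective (le_refl (n + 1)))
  let τ : Equiv.Perm (FlagOrbit α) := Quotient.congr T fun f g => by
    have hT (e : α ≃o α) (f : Flag α) : T (e • f) = e • T f := hα.translation_smul e f le_rfl
    change (MulAction.orbitRel _ _) f g ↔ (MulAction.orbitRel _ _) (T f) (T g)
    rw [MulAction.orbitRel_apply, MulAction.orbitRel_apply, MulAction.mem_orbit_iff,
      MulAction.mem_orbit_iff]
    exact exists_congr fun e => by rw [← hT, T.injective.eq_iff]
  have hτ (f : Flag α) : flagOrbit (translation (n + 1) f) = τ (flagOrbit f) := rfl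
  refine ⟨τ, hτ, τ.bijective.bijOn_univ, fun o _ o' _ => ?_⟩
  obtain ⟨f, rfl⟩ := Quotient.exists_rep o
  obtain ⟨g, rfl⟩ := Quotient.exists_rep o'
  obtain ⟨m, e, h⟩ := H f g
  refine ⟨m, ?_⟩
  have hm (m : ℕ) : (τ ^ m) (flagOrbit f) = flagOrbit ((translation (n + 1))^[m] f) := by
    induction m with
    | zero => rfl
    | succ m ih => rw [pow_succ', Equiv.Perm.mul_apply, ih, Function.iterate_succ_apply', hτ]
  rw [zpow_natCast]
  exact (hm m).trans (flagOrbit_eq_iff.2 ⟨e, h⟩)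

end IsComplex

end Complexes

/-! ### Sets of even vertices maximizing a linear functional -/

section VertexSets

variable {d : ℕ}

lemma even_card_symmDiff (S T : Finset (Fin d)) :
    Even (S ∆ T).card ↔ (Even S.card ↔ Even T.card) := by
  have h1 : (S ∆ T).card = (S \ T).card + (T \ S).card :=
    Finset.card_union_of_disjoint disjoint_sdiff_sdiff
  have h2 := Finset.card_sdiff_add_card_inter S T
  have h3 := Finset.card_sdiff_add_card_inter T S
  rw [Finset.inter_comm] at h3
  simp only [Nat.even_iff]
  omega

/-- The sets of coordinates of odd cardinality, which are the vertices of the cube that the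
half-cube omits. -/
abbrev OddSet (d : ℕ) : Type := {w : Finset (Fin d) // Odd w.card}

/-- The set of vertices of the simplex on the neighbours `w ∆ {i}`, `i ∈ I`, of `w` in the cube. -/
def simplexSet (w I : Finset (Fin d)) : Set (Finset (Fin d)) :=
  {S | ∃ i ∈ I, S = w ∆ {i}}

/-- The even vertices of the face of the cube in which the coordinates in `J` are free and the
others are those of `w`. -/
def subcubeSet (w J : Finset (Fin d)) : Set (Finset (Fin d)) :=
  {S | Even S.card ∧ w ∆ S ⊆ J}

/-- The even vertices `S` at least distance from `w`, where the distance is the sum of the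
weights `a i` of the coordinates in which `S` and `w` differ. -/
def nearestSet (w : Finset (Fin d)) (a : Fin d → ℝ) : Set (Finset (Fin d)) :=
  {S | Even S.card ∧ ∀ S' : Finset (Fin d), Even S'.card →
    ∑ i ∈ w ∆ S, a i ≤ ∑ i ∈ w ∆ S', a i}

/-- The even vertices at which the linear functional with coefficients `c` is largest. -/
def maximizers (c : Fin d → ℝ) : Set (Finset (Fin d)) :=
  {S | Even S.card ∧ ∀ S' : Finset (Fin d), Even S'.card → ∑ i ∈ S', c i ≤ ∑ i ∈ S, c i}

lemma maximizers_eq_nearestSet {w : Finset (Fin d)} {a c : Fin d → ℝ}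
    (h : ∀ i, c i = if i ∈ w then a i else -a i) : maximizers c = nearestSet w a := by
  have key (S : Finset (Fin d)) : ∑ i ∈ S, c i = ∑ i ∈ w, a i - ∑ i ∈ w ∆ S, a i := by
    have hs (S : Finset (Fin d)) (c : Fin d → ℝ) : ∑ i ∈ S, c i = ∑ i, if i ∈ S then c i else 0 := by
      simp
    rw [hs S c, hs w a, hs (w ∆ S) a, ← Finset.sum_sub_distrib]
    refine Finset.sum_congr rfl fun i _ => ?_
    by_cases h1 : i ∈ S <;> by_cases h2 : i ∈ w <;> simp [Finset.mem_symmDiff, h, h1, h2]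
  simp only [maximizers, nearestSet, key, sub_le_sub_iff_left]

lemma even_card_symmDiff_singleton {w : Finset (Fin d)} (hw : Odd w.card) (i : Fin d) :
    Even (w ∆ {i}).card := by
  rw [even_card_symmDiff]
  simp [hw]

lemma nearestSet_eq_simplexSet {w I : Finset (Fin d)} {a : Fin d → ℝ} (hw : Odd w.card)
    (ha : ∀ i, 0 < a i) (hI : ∀ i, i ∈ I ↔ ∀ j, a i ≤ a j) :
    nearestSet w a = simplexSet w I := by
  have hne (S : Finset (Fin d)) (hS : Even S.card) : (w ∆ S).Nonempty := by
    rw [Finset.nonempty_iff_ne_empty]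
    intro h
    have := (even_card_symmDiff w S).1 (by rw [h]; simp)
    exact (Nat.not_even_iff_odd.2 hw) (this.2 hS)
  have hle (S : Finset (Fin d)) {j : Fin d} (hj : j ∈ w ∆ S) : a j ≤ ∑ i ∈ w ∆ S, a i :=
    Finset.single_le_sum (fun i _ => (ha i).le) hj
  have hsing (i : Fin d) : ∑ j ∈ w ∆ (w ∆ {i}), a j = a i := by simp
  ext S
  constructor
  · rintro ⟨hS, hmin⟩
    obtain ⟨j, hj⟩ := hne S hS
    have hjS : w ∆ S = {j} := by
      by_contra hne'
      obtain ⟨k, hk, hkj⟩ : ∃ k ∈ w ∆ S, k ≠ j := by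
        by_contra! hall
        exact hne' (Finset.eq_singleton_iff_unique_mem.2 ⟨hj, hall⟩)
      have h1 := hmin _ (even_card_symmDiff_singleton hw j)
      rw [hsing] at h1
      have h2 : a k + a j ≤ ∑ i ∈ w ∆ S, a i := by
        rw [← Finset.sum_pair hkj]
        exact Finset.sum_le_sum_of_subset_of_nonneg
          (Finset.insert_subset hk (Finset.singleton_subset_iff.2 hj)) fun i _ _ => (ha i).le
      linarith [ha k]
    refine ⟨j, (hI j).2 fun k => ?_, by rw [← hjS, symmDiff_symmDiff_cancel_left]⟩
    have h1 := hmin _ (even_card_symmDiff_singleton hw k)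
    rwa [hsing, hjS, Finset.sum_singleton] at h1
  · rintro ⟨i, hi, rfl⟩
    refine ⟨even_card_symmDiff_singleton hw i, fun S' hS' => ?_⟩
    obtain ⟨j, hj⟩ := hne S' hS'
    rw [hsing]
    exact ((hI i).1 hi j).trans (hle S' hj)

lemma exists_mem_subcubeSet (w : Finset (Fin d)) {J : Finset (Fin d)} (hJ : J.Nonempty) :
    (subcubeSet w J).Nonempty := by
  obtain ⟨j, hj⟩ := hJ
  by_cases hw : Even w.card
  · exact ⟨w, hw, by simp⟩
  · exact ⟨w ∆ {j}, even_card_symmDiff_singleton (Nat.not_even_iff_odd.1 hw) j, by simpa⟩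

lemma nearestSet_eq_subcubeSet {w J : Finset (Fin d)} {a : Fin d → ℝ} (hJne : J.Nonempty)
    (ha : ∀ i, 0 ≤ a i) (hJ : ∀ i, i ∈ J ↔ a i = 0) : nearestSet w a = subcubeSet w J := by
  have hnn (S : Finset (Fin d)) : 0 ≤ ∑ i ∈ S, a i := Finset.sum_nonneg fun i _ => ha i
  have hzero (S : Finset (Fin d)) : ∑ i ∈ S, a i = 0 ↔ S ⊆ J := by
    rw [Finset.sum_eq_zero_iff_of_nonneg fun i _ => ha i]
    exact forall₂_congr fun i _ => (hJ i).symm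
  ext S
  constructor
  · rintro ⟨hS, hmin⟩
    obtain ⟨S', hS', hS'J⟩ := exists_mem_subcubeSet w hJne
    refine ⟨hS, (hzero _).1 ?_⟩
    have := hmin S' hS'
    rw [(hzero _).2 hS'J] at this
    exact this.antisymm (hnn _)
  · rintro ⟨hS, hSJ⟩
    refine ⟨hS, fun S' _ => ?_⟩
    rw [(hzero _).2 hSJ]
    exact hnn _

/-- Two vertices of the cube that agree off `J` span the same subcube in the directions of `J`. -/
lemma subcubeSet_congr {w w' J : Finset (Fin d)} (h : w ∆ w' ⊆ J) :
    subcubeSet w J = subcubeSet w' J := by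
  ext S
  refine and_congr_right fun _ => ?_
  simp only [Finset.subset_iff, Finset.mem_symmDiff] at h ⊢
  grind

lemma exists_odd_symmDiff_subset (w : Finset (Fin d)) {J : Finset (Fin d)} (hJ : J.Nonempty) :
    ∃ w' : OddSet d, w ∆ w'.1 ⊆ J := by
  obtain ⟨j, hj⟩ := hJ
  by_cases hw : Odd w.card
  · exact ⟨⟨w, hw⟩, by simp⟩
  · refine ⟨⟨w ∆ {j}, ?_⟩, by simpa⟩
    rw [← Nat.not_even_iff_odd, even_card_symmDiff]
    rw [Nat.not_odd_iff_even] at hw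
    simp [hw]

/-- In at most two directions, the half-cube spanned at an odd vertex is a simplex. -/
lemma subcubeSet_eq_simplexSet {w J : Finset (Fin d)} (hw : Odd w.card) (hJ : J.card < 3) :
    subcubeSet w J = simplexSet w J := by
  ext S
  constructor
  · rintro ⟨hS, hSJ⟩
    have h1 : ¬ Even (w ∆ S).card := by
      rw [even_card_symmDiff]
      simp [hw, hS]
    have h2 := Finset.card_le_card hSJ
    obtain ⟨j, hj⟩ := Finset.card_eq_one.1 (by
      rw [Nat.even_iff] at h1; omega : (w ∆ S).card = 1)
    exact ⟨j, hSJ (by simp [hj]), by rw [← hj, symmDiff_symmDiff_cancel_left]⟩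
  · rintro ⟨j, hj, rfl⟩
    exact ⟨even_card_symmDiff_singleton hw j, by simpa⟩

/-- The vertex sets of the nonempty faces of the half-cube: let `w` be the set of coordinates in
which the functional is positive. The functional measures the distance to `w`, with the absolute
values of the coefficients as weights. If a coefficient vanishes, or if `w` is even, then the
maximum is the distance zero, else exactly one coordinate is changed, with the least weight. -/
lemma maximizers_eq (hd : 0 < d) (c : Fin d → ℝ) :
    (∃ (w : OddSet d) (I : Finset (Fin d)), maximizers c = simplexSet w.1 I) ∨
    (∃ (w : OddSet d) (J : Finset (Fin d)), 3 ≤ J.card ∧ maximizers c = subcubeSet w.1 J) := by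
  classical
  set w : Finset (Fin d) := Finset.univ.filter fun i => 0 < c i with hw
  have hmax : maximizers c = nearestSet w fun i => |c i| := by
    refine maximizers_eq_nearestSet fun i => ?_
    by_cases hi : 0 < c i
    · simp [hw, hi, abs_of_pos hi]
    · simp [hw, hi, abs_of_nonpos (not_lt.1 hi)]
  set J : Finset (Fin d) := Finset.univ.filter fun i => c i = 0 with hJ
  by_cases hJne : J.Nonempty
  · rw [nearestSet_eq_subcubeSet hJne (fun i => abs_nonneg _) (fun i => by simp [hJ])] at hmax
    obtain ⟨w', hw'⟩ := exists_odd_symmDiff_subset w hJne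
    rw [subcubeSet_congr hw'] at hmax
    by_cases hJ3 : 3 ≤ J.card
    · exact .inr ⟨w', J, hJ3, hmax⟩
    · exact .inl ⟨w', J, hmax.trans (subcubeSet_eq_simplexSet w'.2 (not_le.1 hJ3))⟩
  have hpos (i : Fin d) : 0 < |c i| := by
    rw [abs_pos]
    intro hi
    exact hJne ⟨i, by simp [hJ, hi]⟩
  by_cases hwo : Odd w.card
  · exact .inl ⟨⟨w, hwo⟩, Finset.univ.filter fun i => ∀ j, |c i| ≤ |c j|,
      hmax.trans (nearestSet_eq_simplexSet hwo hpos (by simp))⟩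
  · have i : Fin d := ⟨0, hd⟩
    have hsingle : nearestSet w (fun i => |c i|) = {w} := by
      have hnn (S : Finset (Fin d)) : 0 ≤ ∑ i ∈ S, |c i| :=
        Finset.sum_nonneg fun i _ => abs_nonneg _
      ext S
      constructor
      · rintro ⟨-, hmin⟩
        have h := hmin w (Nat.not_odd_iff_even.1 hwo)
        rw [symmDiff_self, Finset.bot_eq_empty, Finset.sum_empty] at h
        have h0 := (Finset.sum_eq_zero_iff_of_nonneg fun i _ => abs_nonneg _).1 (h.antisymm (hnn _))
        have : w ∆ S = ∅ := Finset.eq_empty_of_forall_notMem fun j hj => (hpos j).ne' (h0 j hj)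
        exact (symmDiff_eq_bot.1 this).symm
      · rintro rfl
        refine ⟨Nat.not_odd_iff_even.1 hwo, fun S' _ => ?_⟩
        simpa using hnn _
    have hodd : Odd (w ∆ {i}).card := by
      rw [← Nat.not_even_iff_odd, even_card_symmDiff]
      simp [Nat.not_odd_iff_even.1 hwo]
    refine .inl ⟨⟨w ∆ {i}, hodd⟩, {i}, ?_⟩
    rw [hmax, hsingle]
    ext S
    simp [simplexSet]

lemma exists_maximizers_eq_simplexSet (w : OddSet d) {I : Finset (Fin d)} (hI : I.Nonempty) :
    ∃ c : Fin d → ℝ, maximizers c = simplexSet w.1 I := by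
  classical
  let a : Fin d → ℝ := fun i => if i ∈ I then 1 else 2
  have ha (i : Fin d) : a i = if i ∈ I then 1 else 2 := rfl
  refine ⟨fun i => if i ∈ w.1 then a i else -a i, (maximizers_eq_nearestSet fun _ => rfl).trans
    (nearestSet_eq_simplexSet w.2 (fun i => ?_) fun i => ?_)⟩
  · rw [ha]
    split_ifs <;> norm_num
  · obtain ⟨j, hj⟩ := hI
    constructor
    · intro hi k
      rw [ha, ha, if_pos hi]
      split_ifs <;> norm_num
    · intro h
      by_contra hi
      have := h j
      rw [ha, ha, if_neg hi, if_pos hj] at this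
      norm_num at this

lemma exists_maximizers_eq_subcubeSet (w : Finset (Fin d)) {J : Finset (Fin d)}
    (hJ : J.Nonempty) : ∃ c : Fin d → ℝ, maximizers c = subcubeSet w J := by
  classical
  let a : Fin d → ℝ := fun i => if i ∈ J then 0 else 1
  have ha (i : Fin d) : a i = if i ∈ J then 0 else 1 := rfl
  refine ⟨fun i => if i ∈ w then a i else -a i, (maximizers_eq_nearestSet fun _ => rfl).trans
    (nearestSet_eq_subcubeSet hJ (fun i => ?_) fun i => ?_)⟩
  · rw [ha]
    split_ifs <;> norm_num
  · rw [ha]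
    split_ifs with h <;> simp [h]

end VertexSets

/-! ### The faces of the half-cube -/

section Faces

variable {d : ℕ}

/-- The vertex of the cube whose coordinates equal to one are those in `S`. -/
def cubeVertex (S : Finset (Fin d)) : Fin d → ℝ := fun i => if i ∈ S then 1 else 0

/-- The set of the vertices of a face, as sets of coordinates. -/
def verts (F : HalfCubeFace d) : Set (Finset (Fin d)) :=
  {S | Even S.card ∧ cubeVertex S ∈ F.1}

lemma halfCube_eq :
    halfCube d = convexHull ℝ (cubeVertex '' {S : Finset (Fin d) | Even S.card}) := by
  rw [halfCube]
  congr 1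
  ext v
  exact ⟨fun ⟨S, hS, hv⟩ => ⟨S, hS, hv.symm⟩, fun ⟨S, hS, hv⟩ => ⟨S, hS, hv.symm⟩⟩

lemma cubeVertex_mem_halfCube {S : Finset (Fin d)} (hS : Even S.card) :
    cubeVertex S ∈ halfCube d := by
  rw [halfCube_eq]
  exact subset_convexHull ℝ _ ⟨S, hS, rfl⟩

lemma isCompact_halfCube : IsCompact (halfCube d) := by
  rw [halfCube_eq]
  exact Set.Finite.isCompact_convexHull (𝕜 := ℝ) ((Set.toFinite _).image _)

lemma convex_halfCube : Convex ℝ (halfCube d) := convex_convexHull ℝ _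

/-- A face is the convex hull of its vertices, by the Krein-Milman theorem. Hence faces are
compared by their vertices. -/
lemma le_iff_verts_subset {F G : HalfCubeFace d} : F ≤ G ↔ verts F ⊆ verts G := by
  refine ⟨fun h S hS => ⟨hS.1, h hS.2⟩, fun h => ?_⟩
  change F.1 ⊆ G.1
  rw [← closure_convexHull_extremePoints (F.2.isCompact isCompact_halfCube)
    (F.2.convex convex_halfCube)]
  refine closure_minimal (convexHull_min (fun x hx => ?_) (G.2.convex convex_halfCube))
    (G.2.isClosed isCompact_halfCube.isClosed)
  have hx' := F.2.isExtreme.extremePoints_subset_extremePoints hx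
  rw [halfCube_eq] at hx'
  obtain ⟨S, hS, rfl⟩ := extremePoints_convexHull_subset hx'
  exact (h ⟨hS, hx.1⟩).2

lemma verts_injective : Function.Injective (verts (d := d)) := fun _ _ h =>
  le_antisymm (le_iff_verts_subset.2 h.le) (le_iff_verts_subset.2 h.ge)

lemma functional_cubeVertex (l : StrongDual ℝ (Fin d → ℝ)) (S : Finset (Fin d)) :
    l (cubeVertex S) = ∑ i ∈ S, l (Pi.single i 1) := by
  have : cubeVertex S = ∑ i ∈ S, Pi.single i (1 : ℝ) := by
    ext j
    simp [cubeVertex, Finset.sum_apply, Pi.single_apply]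
  rw [this, map_sum]

lemma setOf_cubeVertex_mem_toExposed (l : StrongDual ℝ (Fin d → ℝ)) :
    {S : Finset (Fin d) | Even S.card ∧ cubeVertex S ∈ l.toExposed (halfCube d)} =
      maximizers fun i => l (Pi.single i 1) := by
  ext S
  refine and_congr_right fun hS => ?_
  simp only [← functional_cubeVertex]
  constructor
  · exact fun h S' hS' => h.2 _ (cubeVertex_mem_halfCube hS')
  · intro h
    refine ⟨cubeVertex_mem_halfCube hS, fun y hy => ?_⟩
    have hconv : Convex ℝ {y | l y ≤ l (cubeVertex S)} :=
      convex_halfSpace_le l.toLinearMap.isLinear _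
    rw [halfCube_eq] at hy
    exact convexHull_min (by rintro _ ⟨S', hS', rfl⟩; exact h S' hS') hconv hy

lemma exists_verts_eq_maximizers (c : Fin d → ℝ) :
    ∃ F : HalfCubeFace d, verts F = maximizers c := by
  let l : StrongDual ℝ (Fin d → ℝ) := ∑ i, c i • ContinuousLinearMap.proj i
  refine ⟨⟨_, ContinuousLinearMap.toExposed.isExposed (l := l)⟩,
    (setOf_cubeVertex_mem_toExposed l).trans ?_⟩
  congr 1
  funext i
  simp [l, Pi.single_apply]

lemma verts_eq_empty_or_maximizers (F : HalfCubeFace d) :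
    verts F = ∅ ∨ ∃ c : Fin d → ℝ, verts F = maximizers c := by
  rcases Set.eq_empty_or_nonempty F.1 with h | h
  · left
    ext S
    simp [verts, h]
  · right
    obtain ⟨l, hl⟩ := F.2 h
    refine ⟨fun i => l (Pi.single i 1), ?_⟩
    rw [← setOf_cubeVertex_mem_toExposed, verts, hl]
    rfl

lemma exists_verts_eq_empty : ∃ F : HalfCubeFace d, verts F = ∅ :=
  ⟨⟨∅, isExposed_empty⟩, by simp [verts]⟩

lemma exists_verts_eq_simplexSet (w : OddSet d) (I : Finset (Fin d)) :
    ∃ F : HalfCubeFace d, verts F = simplexSet w.1 I := by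
  rcases I.eq_empty_or_nonempty with rfl | hI
  · obtain ⟨F, hF⟩ := exists_verts_eq_empty (d := d)
    exact ⟨F, by simp [hF, simplexSet]⟩
  · obtain ⟨c, hc⟩ := exists_maximizers_eq_simplexSet w hI
    obtain ⟨F, hF⟩ := exists_verts_eq_maximizers c
    exact ⟨F, hF.trans hc⟩

lemma exists_verts_eq_subcubeSet (w : OddSet d) (J : Finset (Fin d)) :
    ∃ F : HalfCubeFace d, verts F = subcubeSet w.1 J := by
  rcases J.eq_empty_or_nonempty with rfl | hJ
  · obtain ⟨F, hF⟩ := exists_verts_eq_simplexSet w ∅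
    exact ⟨F, hF.trans (subcubeSet_eq_simplexSet w.2 (by simp)).symm⟩
  · obtain ⟨c, hc⟩ := exists_maximizers_eq_subcubeSet w.1 hJ
    obtain ⟨F, hF⟩ := exists_verts_eq_maximizers c
    exact ⟨F, hF.trans hc⟩

/-- The face of the half-cube on the neighbours `w ∆ {i}`, `i ∈ I`, of the omitted vertex `w`; it
is a simplex, and it is the empty face if `I` is empty. -/
noncomputable def simplexFace (w : OddSet d) (I : Finset (Fin d)) : HalfCubeFace d :=
  (exists_verts_eq_simplexSet w I).choose

/-- The face of the half-cube in which the coordinates outside `J` are those of `w`. It is itself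
a half-cube, and for `J` with fewer than three elements it is a simplex. -/
noncomputable def subcubeFace (w : OddSet d) (J : Finset (Fin d)) : HalfCubeFace d :=
  (exists_verts_eq_subcubeSet w J).choose

@[simp] lemma verts_simplexFace (w : OddSet d) (I : Finset (Fin d)) :
    verts (simplexFace w I) = simplexSet w.1 I :=
  (exists_verts_eq_simplexSet w I).choose_spec

@[simp] lemma verts_subcubeFace (w : OddSet d) (J : Finset (Fin d)) :
    verts (subcubeFace w J) = subcubeSet w.1 J :=
  (exists_verts_eq_subcubeSet w J).choose_spec

/-- The classification of the faces of the half-cube. -/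
theorem eq_simplexFace_or_subcubeFace (hd : 0 < d) (F : HalfCubeFace d) :
    (∃ (w : OddSet d) (I : Finset (Fin d)), F = simplexFace w I) ∨
    (∃ (w : OddSet d) (J : Finset (Fin d)), 3 ≤ J.card ∧ F = subcubeFace w J) := by
  rcases verts_eq_empty_or_maximizers F with h | ⟨c, hc⟩
  · refine .inl ⟨⟨{⟨0, hd⟩}, by simp⟩, ∅, verts_injective ?_⟩
    simp [h, simplexSet]
  · rcases maximizers_eq hd c with ⟨w, I, h⟩ | ⟨w, J, hJ, h⟩
    · exact .inl ⟨w, I, verts_injective (by rw [hc, h, verts_simplexFace])⟩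
    · exact .inr ⟨w, J, hJ, verts_injective (by rw [hc, h, verts_subcubeFace])⟩

end Faces

/-! ### The order of the faces: heights, coverings, intervals of length two -/

section FaceOrder

variable {d : ℕ}

open Order

lemma mem_simplexSet_iff {w I : Finset (Fin d)} {i : Fin d} :
    w ∆ {i} ∈ simplexSet w I ↔ i ∈ I := by
  constructor
  · rintro ⟨j, hj, h⟩
    rwa [Finset.singleton_injective (symmDiff_right_injective w h)]
  · exact fun h => ⟨i, h, rfl⟩

@[simp] lemma simplexFace_le_simplexFace {w : OddSet d} {I I' : Finset (Fin d)} :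
    simplexFace w I ≤ simplexFace w I' ↔ I ⊆ I' := by
  rw [le_iff_verts_subset, verts_simplexFace, verts_simplexFace]
  constructor
  · exact fun h i hi => mem_simplexSet_iff.1 (h (mem_simplexSet_iff.2 hi))
  · rintro h _ ⟨i, hi, rfl⟩
    exact ⟨i, h hi, rfl⟩

lemma simplexFace_injective (w : OddSet d) : Function.Injective (simplexFace w) := fun _ _ h =>
  (simplexFace_le_simplexFace.1 h.le).antisymm (simplexFace_le_simplexFace.1 h.ge)

lemma simplexFace_lt_simplexFace {w : OddSet d} {I I' : Finset (Fin d)} :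
    simplexFace w I < simplexFace w I' ↔ I ⊂ I' := by
  rw [lt_iff_le_not_ge, simplexFace_le_simplexFace, simplexFace_le_simplexFace]
  rfl

/-- The faces of a simplex are its subsimplices, including the empty one. -/
lemma exists_eq_of_le_simplexFace {w : OddSet d} {I : Finset (Fin d)} {F : HalfCubeFace d}
    (h : F ≤ simplexFace w I) : ∃ I' ⊆ I, F = simplexFace w I' := by
  classical
  rw [le_iff_verts_subset, verts_simplexFace] at h
  refine ⟨I.filter fun i => w.1 ∆ {i} ∈ verts F, Finset.filter_subset _ _, verts_injective ?_⟩
  rw [verts_simplexFace]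
  ext S
  constructor
  · intro hS
    obtain ⟨i, hi, rfl⟩ := h hS
    exact ⟨i, by simp [hi, hS], rfl⟩
  · rintro ⟨i, hi, rfl⟩
    exact (Finset.mem_filter.1 hi).2

lemma simplexFace_empty_eq (w w' : OddSet d) : simplexFace w ∅ = simplexFace w' ∅ :=
  verts_injective (by simp [simplexSet])

/-- If a nonempty simplex at `w` lies in a simplex at `w'`, then `w` and `w'` are equal, or they
differ in at most two directions, among which are those of the smaller simplex. So a triangle
determines the omitted vertex, while an edge has two common neighbours. -/
lemma eq_or_of_simplexFace_le {w w' : OddSet d} {I I' : Finset (Fin d)} (hI : I.Nonempty)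
    (h : simplexFace w I ≤ simplexFace w' I') :
    w = w' ∨ (I ⊆ w.1 ∆ w'.1 ∧ (w.1 ∆ w'.1).card ≤ 2) := by
  rw [le_iff_verts_subset, verts_simplexFace, verts_simplexFace] at h
  by_cases hw : w = w'
  · exact .inl hw
  right
  have key (i) (hi : i ∈ I) : ∃ j, w.1 ∆ w'.1 = {i} ∆ {j} := by
    obtain ⟨j, -, hj⟩ := h (mem_simplexSet_iff.2 hi)
    refine ⟨j, ?_⟩
    rw [← symmDiff_right_inj (a := w.1), symmDiff_symmDiff_cancel_left, ← symmDiff_assoc, hj,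
      symmDiff_symmDiff_cancel_right]
  constructor
  · intro i hi
    obtain ⟨j, hj⟩ := key i hi
    have hij : i ≠ j := by
      rintro rfl
      rw [symmDiff_self] at hj
      exact hw (Subtype.ext (symmDiff_eq_bot.1 hj))
    simp [hj, Finset.mem_symmDiff, hij]
  · obtain ⟨i, hi⟩ := hI
    obtain ⟨j, hj⟩ := key i hi
    rw [hj]
    refine (Finset.card_le_card symmDiff_le_sup).trans ?_
    exact (Finset.card_union_le _ _).trans (by simp)

lemma eq_of_simplexFace_le {w w' : OddSet d} {I I' : Finset (Fin d)} (hI : 3 ≤ I.card)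
    (h : simplexFace w I ≤ simplexFace w' I') : w = w' := by
  rcases eq_or_of_simplexFace_le (Finset.card_pos.1 (by omega)) h with h | ⟨h1, h2⟩
  · exact h
  · have := Finset.card_le_card h1
    omega

lemma subcubeFace_congr {w w' : OddSet d} {J : Finset (Fin d)} (h : w.1 ∆ w'.1 ⊆ J) :
    subcubeFace w J = subcubeFace w' J :=
  verts_injective (by rw [verts_subcubeFace, verts_subcubeFace, subcubeSet_congr h])

lemma simplexFace_le_subcubeFace {w w' : OddSet d} {I J : Finset (Fin d)} (hI : I ⊆ J)
    (h : w'.1 ∆ w.1 ⊆ J) : simplexFace w I ≤ subcubeFace w' J := by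
  rw [subcubeFace_congr h, le_iff_verts_subset, verts_simplexFace, verts_subcubeFace]
  rintro _ ⟨i, hi, rfl⟩
  exact ⟨even_card_symmDiff_singleton w.2 i, by simpa using hI hi⟩

lemma of_simplexFace_le_subcubeFace {w w' : OddSet d} {I J : Finset (Fin d)} (hI : 2 ≤ I.card)
    (h : simplexFace w I ≤ subcubeFace w' J) : I ⊆ J ∧ w'.1 ∆ w.1 ⊆ J := by
  rw [le_iff_verts_subset, verts_simplexFace, verts_subcubeFace] at h
  obtain ⟨a, ha, b, hb, hab⟩ := Finset.one_lt_card.1 hI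
  have key (i) (hi : i ∈ I) : w'.1 ∆ (w.1 ∆ {i}) ⊆ J := (h (mem_simplexSet_iff.2 hi)).2
  simp only [Finset.subset_iff, Finset.mem_symmDiff, Finset.mem_singleton] at key ⊢
  have h1 : ∀ x, ¬ (x ∈ w'.1 ↔ x ∈ w.1) → x ∈ J := by
    intro x hx
    by_cases hxa : x = a
    · have := @key b hb x
      grind
    · have := @key a ha x
      grind
  refine ⟨fun x hx => ?_, fun x hx => h1 x (by grind)⟩
  have h2 := @key x hx x
  have h3 := h1 x
  grind

lemma subcubeFace_le_subcubeFace {w w' : OddSet d} {J J' : Finset (Fin d)} (hJ : J ⊆ J')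
    (h : w'.1 ∆ w.1 ⊆ J') : subcubeFace w J ≤ subcubeFace w' J' := by
  rw [subcubeFace_congr h, le_iff_verts_subset, verts_subcubeFace, verts_subcubeFace]
  exact fun S hS => ⟨hS.1, hS.2.trans hJ⟩

lemma simplexFace_lt_subcubeFace_self (w : OddSet d) {J : Finset (Fin d)} (hJ : 3 ≤ J.card) :
    simplexFace w J < subcubeFace w J := by
  refine (simplexFace_le_subcubeFace le_rfl (by simp)).lt_of_ne fun h => ?_
  have h' := congrArg verts h
  rw [verts_simplexFace, verts_subcubeFace] at h'
  obtain ⟨T, hTJ, hT⟩ := Finset.exists_subset_card_eq hJ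
  have hmem : w.1 ∆ T ∈ subcubeSet w.1 J := by
    refine ⟨?_, by simpa using hTJ⟩
    rw [even_card_symmDiff, hT]
    simp only [Nat.not_even_iff_odd.2 w.2, false_iff]
    decide
  rw [← h'] at hmem
  obtain ⟨i, -, hi⟩ := hmem
  rw [symmDiff_right_injective w.1 hi] at hT
  simp at hT

lemma of_subcubeFace_le_subcubeFace {w w' : OddSet d} {J J' : Finset (Fin d)} (hJ : 3 ≤ J.card)
    (h : subcubeFace w J ≤ subcubeFace w' J') : J ⊆ J' ∧ w'.1 ∆ w.1 ⊆ J' :=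
  of_simplexFace_le_subcubeFace (by omega) ((simplexFace_lt_subcubeFace_self w hJ).le.trans h)

lemma not_subcubeFace_le_simplexFace {w w' : OddSet d} {I J : Finset (Fin d)} (hJ : 3 ≤ J.card) :
    ¬ subcubeFace w J ≤ simplexFace w' I := by
  intro h
  obtain rfl := eq_of_simplexFace_le hJ ((simplexFace_lt_subcubeFace_self w hJ).le.trans h)
  obtain ⟨I', -, hI'⟩ := exists_eq_of_le_simplexFace h
  have h1 := simplexFace_lt_subcubeFace_self w hJ
  have h2 : simplexFace w I' ≤ subcubeFace w J := hI'.ge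
  rw [hI', simplexFace_lt_simplexFace] at h1
  exact h1.2 (of_simplexFace_le_subcubeFace (by have := Finset.card_le_card h1.1; omega) h2).1

/-- The faces of a subcube face, all spanned at omitted vertices that lie in the same subcube. -/
lemma exists_eq_of_le_subcubeFace {w : OddSet d} {J : Finset (Fin d)} {F : HalfCubeFace d}
    (hJ : 3 ≤ J.card) (h : F ≤ subcubeFace w J) :
    (∃ (w' : OddSet d) (I : Finset (Fin d)), w.1 ∆ w'.1 ⊆ J ∧ I ⊆ J ∧ F = simplexFace w' I) ∨
    (∃ (w' : OddSet d) (J' : Finset (Fin d)), w.1 ∆ w'.1 ⊆ J ∧ J' ⊆ J ∧ 3 ≤ J'.card ∧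
      F = subcubeFace w' J') := by
  obtain ⟨j, hj⟩ : J.Nonempty := Finset.card_pos.1 (by omega)
  rcases eq_simplexFace_or_subcubeFace j.pos F with ⟨w', I, rfl⟩ | ⟨w', J', hJ', rfl⟩
  · left
    by_cases hI2 : 2 ≤ I.card
    · obtain ⟨h1, h2⟩ := of_simplexFace_le_subcubeFace hI2 h
      exact ⟨w', I, h2, h1, rfl⟩
    rcases I.eq_empty_or_nonempty with rfl | hI
    · exact ⟨w, ∅, by simp, by simp, simplexFace_empty_eq _ _⟩
    obtain ⟨i, rfl⟩ := Finset.card_eq_one.1 (by have := hI.card_pos; omega : I.card = 1)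
    -- a vertex in the subcube is a neighbour of an omitted vertex in the same subcube
    have hS : w'.1 ∆ {i} ∈ subcubeSet w.1 J := by
      rw [le_iff_verts_subset, verts_simplexFace, verts_subcubeFace] at h
      exact h (mem_simplexSet_iff.2 (by simp))
    have hodd : Odd ((w'.1 ∆ {i}) ∆ {j}).card := by
      rw [← Nat.not_even_iff_odd, even_card_symmDiff]
      simp [hS.1]
    refine ⟨⟨(w'.1 ∆ {i}) ∆ {j}, hodd⟩, {j}, ?_, by simpa, verts_injective ?_⟩
    · rw [← symmDiff_assoc]
      exact symmDiff_le_sup.trans (Finset.union_subset hS.2 (by simpa))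
    · ext S
      simp [simplexSet, symmDiff_symmDiff_cancel_right]
  · right
    obtain ⟨h1, h2⟩ := of_subcubeFace_le_subcubeFace hJ' h
    exact ⟨w', J', h2, h1, hJ', rfl⟩

@[simp] lemma height_simplexFace (w : OddSet d) (I : Finset (Fin d)) :
    height (simplexFace w I) = I.card := by
  classical
  induction I using Finset.strongInduction with
  | H I ih =>
    apply le_antisymm
    · rw [height_le_coe_iff]
      intro F hF
      obtain ⟨I', hI', rfl⟩ := exists_eq_of_le_simplexFace hF.le
      rw [simplexFace_lt_simplexFace] at hF
      rw [ih I' hF]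
      exact_mod_cast Finset.card_lt_card hF
    · rcases I.eq_empty_or_nonempty with rfl | ⟨i, hi⟩
      · simp
      · have h := height_add_one_le (simplexFace_lt_simplexFace (w := w).2 (Finset.erase_ssubset hi))
        rw [ih _ (Finset.erase_ssubset hi)] at h
        rw [← Finset.card_erase_add_one hi]
        exact_mod_cast h

lemma height_subcubeFace (w : OddSet d) {J : Finset (Fin d)} (hJ : 3 ≤ J.card) :
    height (subcubeFace w J) = ((J.card + 1 : ℕ) : ℕ∞) := by
  induction J using Finset.strongInduction generalizing w with
  | H J ih =>
    apply le_antisymm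
    · rw [height_le_coe_iff]
      intro F hF
      rcases exists_eq_of_le_subcubeFace hJ hF.le with
        ⟨w', I, -, hI, rfl⟩ | ⟨w', J', hw', hJJ', hJ', rfl⟩
      · rw [height_simplexFace]
        exact_mod_cast Nat.lt_succ_iff.2 (Finset.card_le_card hI)
      · have hss : J' ⊂ J := hJJ'.ssubset_of_ne fun h => by
          subst h
          exact hF.ne (subcubeFace_congr hw').symm
        rw [ih J' hss w' hJ']
        exact_mod_cast Nat.succ_lt_succ (Finset.card_lt_card hss)
    · have h := height_add_one_le (simplexFace_lt_subcubeFace_self w hJ)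
      rw [height_simplexFace] at h
      exact_mod_cast h

lemma eq_simplexFace_or_subcubeFace_of_height (hd : 0 < d) {F : HalfCubeFace d} {m : ℕ}
    (h : height F = m) :
    (∃ (w : OddSet d) (I : Finset (Fin d)), I.card = m ∧ F = simplexFace w I) ∨
    (∃ (w : OddSet d) (J : Finset (Fin d)), 3 ≤ J.card ∧ J.card + 1 = m ∧ F = subcubeFace w J) := by
  rcases eq_simplexFace_or_subcubeFace hd F with ⟨w, I, rfl⟩ | ⟨w, J, hJ, rfl⟩
  · rw [height_simplexFace] at h
    exact .inl ⟨w, I, by exact_mod_cast h, rfl⟩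
  · rw [height_subcubeFace w hJ] at h
    exact .inr ⟨w, J, hJ, by exact_mod_cast h, rfl⟩

lemma exists_eq_of_covBy_simplexFace {w : OddSet d} {I : Finset (Fin d)} {F : HalfCubeFace d}
    (h : F ⋖ simplexFace w I) : ∃ i ∈ I, F = simplexFace w (I.erase i) := by
  obtain ⟨I', hI', rfl⟩ := exists_eq_of_le_simplexFace h.le
  obtain ⟨i, hi, hiI'⟩ := Finset.exists_of_ssubset (simplexFace_lt_simplexFace.1 h.lt)
  have hsub : I' ⊆ I.erase i := Finset.subset_erase.2 ⟨hI', hiI'⟩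
  rcases hsub.eq_or_ssubset with rfl | hss
  · exact ⟨i, hi, rfl⟩
  · exact absurd (simplexFace_lt_simplexFace.2 (Finset.erase_ssubset hi))
      (h.2 (simplexFace_lt_simplexFace.2 hss))

lemma subcubeFace_lt_subcubeFace {w w' : OddSet d} {J J' : Finset (Fin d)} (hJ : 3 ≤ J.card)
    (hJJ' : J ⊂ J') (h : w'.1 ∆ w.1 ⊆ J') : subcubeFace w J < subcubeFace w' J' := by
  refine (subcubeFace_le_subcubeFace hJJ'.1 h).lt_of_not_ge fun h' => hJJ'.2 ?_
  exact (of_subcubeFace_le_subcubeFace (hJ.trans (Finset.card_le_card hJJ'.1)) h').1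

lemma exists_eq_of_covBy_subcubeFace {w : OddSet d} {J : Finset (Fin d)} (hJ : 3 ≤ J.card)
    {F : HalfCubeFace d} (h : F ⋖ subcubeFace w J) :
    (∃ w' : OddSet d, w.1 ∆ w'.1 ⊆ J ∧ F = simplexFace w' J) ∨
    (∃ w' : OddSet d, w.1 ∆ w'.1 ⊆ J ∧ ∃ j ∈ J, 4 ≤ J.card ∧ F = subcubeFace w' (J.erase j)) := by
  rcases exists_eq_of_le_subcubeFace hJ h.le with
    ⟨w', I, hw', hI, rfl⟩ | ⟨w', J', hw', hJJ', hJ', rfl⟩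
  · left
    rcases hI.eq_or_ssubset with rfl | hss
    · exact ⟨w', hw', rfl⟩
    · refine absurd ?_ (h.2 (simplexFace_lt_simplexFace.2 hss))
      rw [subcubeFace_congr hw']
      exact simplexFace_lt_subcubeFace_self w' hJ
  · right
    have hss : J' ⊂ J := hJJ'.ssubset_of_ne fun e => by
      subst e
      exact h.lt.ne (subcubeFace_congr hw').symm
    have hcard := Finset.card_lt_card hss
    obtain ⟨j, hj, hjJ'⟩ := Finset.exists_of_ssubset hss
    have hsub : J' ⊆ J.erase j := Finset.subset_erase.2 ⟨hJJ', hjJ'⟩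
    rcases hsub.eq_or_ssubset with rfl | hss'
    · exact ⟨w', hw', j, hj, by omega, rfl⟩
    · have hcard' : 3 ≤ (J.erase j).card := hJ'.trans (Finset.card_le_card hsub)
      exact absurd (subcubeFace_lt_subcubeFace hcard' (Finset.erase_ssubset hj) hw')
        (h.2 (subcubeFace_lt_subcubeFace hJ' hss' (by simp)))

lemma height_eq_of_covBy (hd : 0 < d) {F G : HalfCubeFace d} (h : F ⋖ G) :
    height G = height F + 1 := by
  rcases eq_simplexFace_or_subcubeFace hd G with ⟨w, I, rfl⟩ | ⟨w, J, hJ, rfl⟩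
  · obtain ⟨i, hi, rfl⟩ := exists_eq_of_covBy_simplexFace h
    rw [height_simplexFace, height_simplexFace, ← Finset.card_erase_add_one hi]
    norm_cast
  · rw [height_subcubeFace w hJ]
    rcases exists_eq_of_covBy_subcubeFace hJ h with ⟨w', -, rfl⟩ | ⟨w', -, j, hj, hJ4, rfl⟩
    · rw [height_simplexFace]
      norm_cast
    · have := Finset.card_erase_add_one hj
      rw [height_subcubeFace w' (by omega), this]
      norm_cast

/-- The interval between a simplex on `I` and the subcube in the directions of `insert a I`. -/
lemma eq_of_mem_Ioo_simplexFace_subcubeFace {w : OddSet d} {I : Finset (Fin d)} {a : Fin d}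
    (ha : a ∉ I) (hI : 2 ≤ I.card) {F : HalfCubeFace d}
    (h : F ∈ Set.Ioo (simplexFace w I) (subcubeFace w (insert a I))) :
    F = simplexFace w (insert a I) ∨ (3 ≤ I.card ∧ F = subcubeFace w I) ∨
    (I.card = 2 ∧ ∃ w' : OddSet d, w'.1 = w.1 ∆ I ∧ F = simplexFace w' (insert a I)) := by
  have hcard := Finset.card_insert_of_notMem ha
  have : Finite (HalfCubeFace d) := Finite.of_injective _ verts_injective
  have h1 := height_lt_height h.1
  have h2 := height_lt_height h.2
  rw [height_simplexFace] at h1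
  rw [height_subcubeFace w (by omega), hcard] at h2
  rcases exists_eq_of_le_subcubeFace (by omega) h.2.le with
    ⟨w', I', -, hI', rfl⟩ | ⟨w', J', -, hJJ', hJ', rfl⟩
  · rw [height_simplexFace] at h1 h2
    norm_cast at h1 h2
    obtain rfl := Finset.eq_of_subset_of_card_le hI' (by omega)
    rcases eq_or_of_simplexFace_le (Finset.card_pos.1 (by omega)) h.1.le with rfl | ⟨h3, h4⟩
    · exact .inl rfl
    · have h5 := Finset.eq_of_subset_of_card_le h3 (by omega)
      refine .inr (.inr ⟨by rw [← h5] at h4; omega, w', ?_, rfl⟩)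
      rw [h5, symmDiff_symmDiff_cancel_left]
  · rw [height_subcubeFace w' hJ'] at h1 h2
    norm_cast at h1 h2
    obtain ⟨h3, h4⟩ := of_simplexFace_le_subcubeFace hI h.1.le
    obtain rfl := Finset.eq_of_subset_of_card_le h3 (by omega)
    exact .inr (.inl ⟨hJ', by rw [subcubeFace_congr h4]⟩)

lemma ncard_Ioo_simplexFace_subcubeFace {w : OddSet d} {I : Finset (Fin d)} {a : Fin d}
    (ha : a ∉ I) (hI : 2 ≤ I.card) :
    (Set.Ioo (simplexFace w I) (subcubeFace w (insert a I))).ncard = 2 := by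
  have hcard := Finset.card_insert_of_notMem ha
  have hlt (w' : OddSet d) (h : w.1 ∆ w'.1 ⊆ insert a I) :
      simplexFace w' (insert a I) < subcubeFace w (insert a I) := by
    rw [subcubeFace_congr h]
    exact simplexFace_lt_subcubeFace_self _ (by omega)
  rw [Set.ncard_eq_two]
  by_cases hI3 : 3 ≤ I.card
  · refine ⟨simplexFace w (insert a I), subcubeFace w I, fun h => ?_, ?_⟩
    · exact not_subcubeFace_le_simplexFace hI3 h.ge
    · ext F
      constructor
      · intro h
        rcases eq_of_mem_Ioo_simplexFace_subcubeFace ha hI h with rfl | ⟨-, rfl⟩ | ⟨h2, -⟩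
        · simp
        · simp
        · omega
      · rintro (rfl | rfl)
        · exact ⟨simplexFace_lt_simplexFace.2 (Finset.ssubset_insert ha), hlt w (by simp)⟩
        · exact ⟨simplexFace_lt_subcubeFace_self w hI3,
            subcubeFace_lt_subcubeFace hI3 (Finset.ssubset_insert ha) (by simp)⟩
  · have hI2 : I.card = 2 := by omega
    have hodd : Odd (w.1 ∆ I).card := by
      rw [← Nat.not_even_iff_odd, even_card_symmDiff, hI2]
      simp [Nat.not_even_iff_odd.2 w.2]
    obtain ⟨w', hw'⟩ : ∃ w' : OddSet d, w'.1 = w.1 ∆ I := ⟨⟨_, hodd⟩, rfl⟩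
    have hww' : simplexFace w I = simplexFace w' I := by
      -- both ends of an edge are neighbours of both omitted vertices
      obtain ⟨b, c, hbc, rfl⟩ := Finset.card_eq_two.1 hI2
      refine verts_injective ?_
      have hpair : ({b, c} : Finset (Fin d)) = {b} ∆ {c} := by
        ext x
        simp only [Finset.mem_symmDiff, Finset.mem_insert, Finset.mem_singleton]
        grind
      have e1 : w'.1 ∆ {b} = w.1 ∆ {c} := by
        rw [hw', hpair, symmDiff_comm ({b} : Finset (Fin d)), symmDiff_assoc, symmDiff_symmDiff_cancel_right]
      have e2 : w'.1 ∆ {c} = w.1 ∆ {b} := by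
        rw [hw', hpair, symmDiff_assoc, symmDiff_symmDiff_cancel_right]
      ext S
      simp [simplexSet, e1, e2, or_comm]
    refine ⟨simplexFace w (insert a I), simplexFace w' (insert a I), fun h => ?_, ?_⟩
    · have := congrArg Subtype.val (eq_of_simplexFace_le (by omega) h.le)
      rw [hw', eq_comm, symmDiff_eq_left, Finset.bot_eq_empty] at this
      simp [this] at hI2
    · ext F
      constructor
      · intro h
        rcases eq_of_mem_Ioo_simplexFace_subcubeFace ha hI h with rfl | ⟨h3, -⟩ | ⟨-, w'', h'', rfl⟩
        · simp
        · omega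
        · rw [Subtype.ext (h''.trans hw'.symm)]
          simp
      · rintro (rfl | rfl)
        · exact ⟨simplexFace_lt_simplexFace.2 (Finset.ssubset_insert ha), hlt w (by simp)⟩
        · refine ⟨?_, hlt w' (by rw [hw', symmDiff_symmDiff_cancel_left]; exact Finset.subset_insert _ _)⟩
          rw [hww']
          exact simplexFace_lt_simplexFace.2 (Finset.ssubset_insert ha)

lemma ncard_Ioo_finset {A B : Finset (Fin d)} (h : A ⊆ B) (hcard : B.card = A.card + 2) :
    (Set.Ioo A B).ncard = 2 := by
  have hs : (B \ A).card = 2 := by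
    rw [Finset.card_sdiff_of_subset h]
    omega
  obtain ⟨a, b, hab, he⟩ := Finset.card_eq_two.1 hs
  have hB : B = insert a (insert b A) := by
    rw [← Finset.union_sdiff_of_subset h, he]
    ext x
    simp only [Finset.mem_union, Finset.mem_insert, Finset.mem_singleton]
    tauto
  have ha : a ∉ A := (Finset.mem_sdiff.1 (by rw [he]; simp : a ∈ B \ A)).2
  have hb : b ∉ A := (Finset.mem_sdiff.1 (by rw [he]; simp : b ∈ B \ A)).2
  rw [Set.ncard_eq_two]
  refine ⟨insert a A, insert b A, fun e => ?_, ?_⟩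
  · have : a ∈ insert b A := e ▸ Finset.mem_insert_self a A
    simp [hab, ha] at this
  · ext C
    simp only [Set.mem_Ioo, Set.mem_insert_iff, Set.mem_singleton_iff]
    constructor
    · rintro ⟨h1, h2⟩
      obtain ⟨c, hc, hcA⟩ := Finset.exists_of_ssubset h1
      have h3 := Finset.card_lt_card h1
      have h4 := Finset.card_lt_card h2
      have hcB := h2.1 hc
      have hC : insert c A = C := Finset.eq_of_subset_of_card_le
        (Finset.insert_subset hc h1.1) (by rw [Finset.card_insert_of_notMem hcA]; omega)
      rw [hB] at hcB
      simp only [Finset.mem_insert, hcA, or_false] at hcB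
      rcases hcB with rfl | rfl
      · exact .inl hC.symm
      · exact .inr hC.symm
    · rintro (rfl | rfl)
      · exact ⟨Finset.ssubset_insert ha, by
          rw [hB, Finset.insert_comm]; exact Finset.ssubset_insert (by simp [hab.symm, hb])⟩
      · exact ⟨Finset.ssubset_insert hb, by
          rw [hB]; exact Finset.ssubset_insert (by simp [hab, ha])⟩

lemma ncard_Ioo_eq_two (hd : 0 < d) {F G : HalfCubeFace d} (hFG : F ≤ G)
    (h : height G = height F + 2) : (Set.Ioo F G).ncard = 2 := by
  rcases eq_simplexFace_or_subcubeFace hd G with ⟨w, I, rfl⟩ | ⟨w, J, hJ, rfl⟩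
  · obtain ⟨I', hI', rfl⟩ := exists_eq_of_le_simplexFace hFG
    rw [height_simplexFace, height_simplexFace] at h
    rw [← ncard_Ioo_finset hI' (by exact_mod_cast h),
      ← Set.ncard_image_of_injective _ (simplexFace_injective w)]
    congr 1
    ext F
    constructor
    · intro hF
      obtain ⟨K, -, rfl⟩ := exists_eq_of_le_simplexFace hF.2.le
      exact ⟨K, ⟨simplexFace_lt_simplexFace.1 hF.1, simplexFace_lt_simplexFace.1 hF.2⟩, rfl⟩
    · rintro ⟨K, hK, rfl⟩
      exact ⟨simplexFace_lt_simplexFace.2 hK.1, simplexFace_lt_simplexFace.2 hK.2⟩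
  · rw [height_subcubeFace w hJ] at h
    rcases exists_eq_of_le_subcubeFace hJ hFG with
      ⟨w', I, hw', hI, rfl⟩ | ⟨w', J', hw', hJJ', hJ', rfl⟩
    · rw [height_simplexFace] at h
      norm_cast at h
      obtain ⟨a, ha, rfl⟩ : ∃ a, a ∉ I ∧ J = insert a I := by
        obtain ⟨a, ha⟩ := Finset.card_eq_one.1
          (by rw [Finset.card_sdiff_of_subset hI]; omega : (J \ I).card = 1)
        refine ⟨a, (Finset.mem_sdiff.1 (by rw [ha]; simp : a ∈ J \ I)).2, ?_⟩
        rw [← Finset.union_sdiff_of_subset hI, ha, Finset.union_comm]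
        rfl
      rw [subcubeFace_congr hw']
      exact ncard_Ioo_simplexFace_subcubeFace ha (by
        rw [Finset.card_insert_of_notMem ha] at hJ; omega)
    · rw [height_subcubeFace w' hJ'] at h
      norm_cast at h
      rw [subcubeFace_congr hw']
      have hinj : Set.InjOn (subcubeFace w') (Set.Ioo J' J) := fun K hK K' hK' e =>
        (of_subcubeFace_le_subcubeFace (hJ'.trans (Finset.card_le_card hK.1.1)) e.le).1.antisymm
          (of_subcubeFace_le_subcubeFace (hJ'.trans (Finset.card_le_card hK'.1.1)) e.ge).1
      rw [← ncard_Ioo_finset hJJ' (by omega), ← hinj.ncard_image]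
      congr 1
      ext F
      constructor
      · intro hF
        rcases exists_eq_of_le_subcubeFace hJ hF.2.le with
          ⟨w'', I, -, -, rfl⟩ | ⟨w'', K, -, hKJ, hK, rfl⟩
        · exact absurd hF.1.le (not_subcubeFace_le_simplexFace hJ')
        · obtain ⟨h1, h2⟩ := of_subcubeFace_le_subcubeFace hJ' hF.1.le
          rw [subcubeFace_congr h2] at hF ⊢
          refine ⟨K, ⟨h1.ssubset_of_ne ?_, hKJ.ssubset_of_ne ?_⟩, rfl⟩
          · rintro rfl
            exact lt_irrefl _ hF.1
          · rintro rfl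
            exact lt_irrefl _ hF.2
      · rintro ⟨K, hK, rfl⟩
        exact ⟨subcubeFace_lt_subcubeFace hJ' hK.1 (by simp),
          subcubeFace_lt_subcubeFace (hJ'.trans (Finset.card_le_card hK.1.1)) hK.2 (by simp)⟩

end FaceOrder

/-! ### The flags of the half-cube and their number -/

section Flags

variable {d : ℕ}

open Order

/-- The first `r` elements of `Fin d` in the order given by the permutation `π`. -/
def initialSet (π : Equiv.Perm (Fin d)) (r : ℕ) : Finset (Fin d) :=
  Finset.univ.filter fun x => (π.symm x).val < r

@[simp] lemma mem_initialSet {π : Equiv.Perm (Fin d)} {r : ℕ} {x : Fin d} :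
    x ∈ initialSet π r ↔ (π.symm x).val < r := by
  simp [initialSet]

lemma initialSet_mono (π : Equiv.Perm (Fin d)) {r s : ℕ} (h : r ≤ s) :
    initialSet π r ⊆ initialSet π s := fun x hx => by
  rw [mem_initialSet] at hx ⊢
  omega

lemma map_initialSet (π τ : Equiv.Perm (Fin d)) (r : ℕ) :
    (initialSet π r).map τ.toEmbedding = initialSet (τ * π) r := by
  ext x
  simp only [Finset.mem_map_equiv, mem_initialSet]
  rfl

lemma card_initialSet (π : Equiv.Perm (Fin d)) {r : ℕ} (h : r ≤ d) :
    (initialSet π r).card = r := by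
  have h1 : initialSet π r = (initialSet 1 r).map π.toEmbedding := by
    rw [map_initialSet, mul_one]
  have h2 : initialSet (1 : Equiv.Perm (Fin d)) r = Finset.univ.filter fun x => x.val < r := rfl
  rw [h1, Finset.card_map, h2, Fin.card_filter_val_lt]
  omega

lemma initialSet_succ (π : Equiv.Perm (Fin d)) {r : ℕ} (h : r < d) :
    initialSet π (r + 1) = insert (π ⟨r, h⟩) (initialSet π r) := by
  ext x
  rw [Finset.mem_insert, mem_initialSet, mem_initialSet, ← Equiv.symm_apply_eq, Fin.ext_iff]
  change _ ↔ (π.symm x).val = r ∨ _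
  omega

lemma notMem_initialSet (π : Equiv.Perm (Fin d)) {r : ℕ} (h : r < d) :
    π ⟨r, h⟩ ∉ initialSet π r := by
  simp

/-- Any element of the initial set of size `r + 1` can be made the last one to be added to it. -/
lemma exists_initialSet_eq_erase (π : Equiv.Perm (Fin d)) {r : ℕ} (h : r < d) {i : Fin d}
    (hi : i ∈ initialSet π (r + 1)) : ∃ π' : Equiv.Perm (Fin d),
      (∀ s, r + 1 ≤ s → initialSet π' s = initialSet π s) ∧
      initialSet π' r = (initialSet π (r + 1)).erase i := by
  rw [mem_initialSet] at hi
  have hr : (π.symm (π ⟨r, h⟩)).val = r := by simp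
  have key (x : Fin d) : (Equiv.swap i (π ⟨r, h⟩) * π).symm x =
      π.symm (Equiv.swap i (π ⟨r, h⟩) x) := rfl
  refine ⟨Equiv.swap i (π ⟨r, h⟩) * π, fun s hs => ?_, ?_⟩
  · ext x
    rw [mem_initialSet, mem_initialSet, key, Equiv.swap_apply_def]
    split_ifs with h1 h2
    · subst h1
      omega
    · subst h2
      omega
    · rfl
  · ext x
    rw [Finset.mem_erase, mem_initialSet, mem_initialSet, key, Equiv.swap_apply_def]
    split_ifs with h1 h2
    · simp [h1]
    · subst h2
      have hne : (π.symm i).val ≠ r := by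
        intro h3
        apply h1
        rw [← π.symm_apply_eq.1 (Fin.ext h3 : π.symm i = ⟨r, h⟩)]
      rw [hr]
      constructor
      · exact fun _ => ⟨h1, by omega⟩
      · omega
    · have hne : (π.symm x).val ≠ r := by
        intro h3
        exact h2 (π.symm_apply_eq.1 (Fin.ext h3 : π.symm x = ⟨r, h⟩))
      constructor
      · exact fun h3 => ⟨h1, by omega⟩
      · rintro ⟨-, h3⟩
        omega

/-- The data `(w, π, k)` that describe a flag of the half-cube: the omitted vertex `w`, the order `π`
in which the coordinates are added, and the largest height `k` of a face of the form
`simplexFace w I` in the flag. -/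
abbrev FlagData (d : ℕ) : Type := OddSet d × Equiv.Perm (Fin d) × Set.Icc 3 d

/-- The face of height `r` of the flag described by the data `(w, π, k)`. -/
noncomputable def flagFace (p : FlagData d) (r : ℕ) : HalfCubeFace d :=
  if r ≤ p.2.2.1 then simplexFace p.1 (initialSet p.2.1 r)
  else subcubeFace p.1 (initialSet p.2.1 (r - 1))

lemma flagFace_of_le {p : FlagData d} {r : ℕ} (h : r ≤ p.2.2.1) :
    flagFace p r = simplexFace p.1 (initialSet p.2.1 r) := if_pos h

lemma flagFace_succ_of_le {p : FlagData d} {r : ℕ} (h : p.2.2.1 ≤ r) :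
    flagFace p (r + 1) = subcubeFace p.1 (initialSet p.2.1 r) :=
  if_neg (Nat.not_le.2 (Nat.lt_succ_of_le h))

lemma height_flagFace (p : FlagData d) {r : ℕ} (hr : r ≤ d + 1) :
    height (flagFace p r) = r := by
  have h3 := p.2.2.2.1
  have hd := p.2.2.2.2
  by_cases h : r ≤ p.2.2.1
  · rw [flagFace_of_le h, height_simplexFace, card_initialSet _ (by omega)]
  · obtain ⟨r, rfl⟩ : ∃ s, r = s + 1 := ⟨r - 1, by omega⟩
    have hc := card_initialSet p.2.1 (r := r) (by omega)
    rw [flagFace_succ_of_le (by omega), height_subcubeFace _ (by omega), hc]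

lemma flagFace_le_flagFace (p : FlagData d) {r s : ℕ} (hrs : r ≤ s) :
    flagFace p r ≤ flagFace p s := by
  by_cases h : s ≤ p.2.2.1
  · rw [flagFace_of_le h, flagFace_of_le (by omega), simplexFace_le_simplexFace]
    exact initialSet_mono _ hrs
  obtain ⟨s, rfl⟩ : ∃ t, s = t + 1 := ⟨s - 1, by omega⟩
  rw [flagFace_succ_of_le (by omega)]
  by_cases h' : r ≤ p.2.2.1
  · rw [flagFace_of_le h']
    exact simplexFace_le_subcubeFace (initialSet_mono _ (by omega)) (by simp)
  · obtain ⟨r, rfl⟩ : ∃ t, r = t + 1 := ⟨r - 1, by omega⟩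
    rw [flagFace_succ_of_le (by omega)]
    exact subcubeFace_le_subcubeFace (initialSet_mono _ (by omega)) (by simp)

/-- In a flag, an element that is not the lowest one covers another element of the flag. -/
lemma exists_covBy_of_mem_flag {α : Type*} [PartialOrder α] [Finite α] (f : Flag α) {y z : α}
    (hy : y ∈ f) (hz : z ∈ f) (hzy : z < y) : ∃ x ∈ f, x ⋖ y := by
  obtain ⟨x, hx⟩ := (Set.toFinite {x | x ∈ f ∧ x < y}).exists_maximal ⟨z, hz, hzy⟩
  refine ⟨x, hx.prop.1, hx.prop.2, fun u hxu huy => ?_⟩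
  have hu : u ∈ f := by
    rw [Flag.mem_iff_forall_le_or_ge]
    intro v hv
    rcases f.le_or_le hv hy with h | h
    · rcases h.eq_or_lt with rfl | h
      · exact .inl huy.le
      · rcases f.le_or_le hv hx.prop.1 with h' | h'
        · exact .inr (h'.trans hxu.le)
        · exact .inr ((hx.le_of_ge ⟨hv, h⟩ h').trans hxu.le)
    · exact .inl (huy.le.trans h)
  exact hxu.not_ge (hx.le_of_ge ⟨hu, huy⟩ hxu.le)

instance : Finite (HalfCubeFace d) := Finite.of_injective _ verts_injective

lemma isBot_simplexFace_empty (w : OddSet d) : IsBot (simplexFace w ∅) := fun F => by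
  rw [le_iff_verts_subset, verts_simplexFace]
  simp [simplexSet]

lemma isTop_subcubeFace_univ (w : OddSet d) : IsTop (subcubeFace w Finset.univ) := fun F => by
  rw [le_iff_verts_subset, verts_subcubeFace]
  exact fun S hS => ⟨hS.1, Finset.subset_univ _⟩

lemma mem_flag_of_isBot {α : Type*} [PartialOrder α] (f : Flag α) {x : α} (h : IsBot x) : x ∈ f :=
  Flag.mem_iff_forall_le_or_ge.2 fun _ _ => .inl (h _)

lemma mem_flag_of_isTop {α : Type*} [PartialOrder α] (f : Flag α) {x : α} (h : IsTop x) : x ∈ f :=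
  Flag.mem_iff_forall_le_or_ge.2 fun _ _ => .inr (h _)

lemma initialSet_eq_univ (π : Equiv.Perm (Fin d)) : initialSet π d = Finset.univ := by
  ext x
  simp

/-- Every flag of the half-cube is described by data `(w, π, k)`. These are found by descending
along the flag: the order of the coordinates is adjusted below the current height only. -/
lemma exists_flagData (hd : 3 ≤ d) (f : Flag (HalfCubeFace d)) :
    ∃ p : FlagData d, ∀ s ≤ d + 1, flagFace p s ∈ f := by
  suffices H : ∀ m ≤ d + 1, ∃ p : FlagData d, ∀ s, m ≤ s → s ≤ d + 1 → flagFace p s ∈ f by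
    obtain ⟨p, hp⟩ := H 0 (Nat.zero_le _)
    exact ⟨p, fun s hs => hp s (Nat.zero_le _) hs⟩
  intro m hm
  induction hm using Nat.decreasingInduction with
  | self =>
    have w : OddSet d := ⟨{⟨0, by omega⟩}, by simp⟩
    refine ⟨⟨w, 1, 3, le_rfl, hd⟩, fun s hs hs' => ?_⟩
    obtain rfl : s = d + 1 := by omega
    rw [flagFace_succ_of_le hd, initialSet_eq_univ]
    exact mem_flag_of_isTop f (isTop_subcubeFace_univ _)
  | of_succ r hr ih =>
    obtain ⟨p, hp⟩ := ih
    have hy := hp (r + 1) le_rfl (by omega)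
    -- it suffices to find data that agree above the height `r` and give the element of height `r`
    have finish (q : FlagData d) (h1 : ∀ s, r + 1 ≤ s → s ≤ d + 1 → flagFace q s = flagFace p s)
        (h2 : flagFace q r ∈ f) : ∃ p : FlagData d, ∀ s, r ≤ s → s ≤ d + 1 → flagFace p s ∈ f := by
      refine ⟨q, fun s hs hs' => ?_⟩
      rcases hs.eq_or_lt with rfl | hlt
      · exact h2
      · rw [h1 s hlt hs']
        exact hp s hlt hs'
    have hbot := mem_flag_of_isBot f (isBot_simplexFace_empty p.1)
    have hlt : simplexFace p.1 ∅ < flagFace p (r + 1) := by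
      refine (isBot_simplexFace_empty p.1 _).lt_of_ne fun h => ?_
      have := congrArg height h
      rw [height_simplexFace, height_flagFace p (by omega)] at this
      norm_cast at this
    obtain ⟨x, hx, hcov⟩ := exists_covBy_of_mem_flag f hy hbot hlt
    obtain ⟨w, π, k, hk3, hkd⟩ := p
    by_cases hrk : r + 1 ≤ k
    · rw [flagFace_of_le hrk] at hcov
      obtain ⟨i, hi, rfl⟩ := exists_eq_of_covBy_simplexFace hcov
      obtain ⟨π', h1, h2⟩ := exists_initialSet_eq_erase π (by omega) hi
      refine finish ⟨w, π', k, hk3, hkd⟩ (fun s hs hs' => ?_) ?_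
      · by_cases hsk : s ≤ k
        · rw [flagFace_of_le hsk, flagFace_of_le hsk, h1 s hs]
        · obtain ⟨s, rfl⟩ : ∃ t, s = t + 1 := ⟨s - 1, by omega⟩
          rw [flagFace_succ_of_le (by change k ≤ s; omega),
            flagFace_succ_of_le (by change k ≤ s; omega), h1 s (by omega)]
      · rw [flagFace_of_le (by change r ≤ k; omega), h2]
        exact hx
    · have hkr : k ≤ r := by omega
      rw [flagFace_succ_of_le hkr] at hcov
      have hcard := card_initialSet π (r := r) (by omega)
      rcases exists_eq_of_covBy_subcubeFace (by rw [hcard]; omega) hcov with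
        ⟨w', hw', rfl⟩ | ⟨w', hw', j, hj, h4, rfl⟩
      · refine finish ⟨w', π, r, by omega, by omega⟩ (fun s hs hs' => ?_) ?_
        · obtain ⟨s, rfl⟩ : ∃ t, s = t + 1 := ⟨s - 1, by omega⟩
          rw [flagFace_succ_of_le (by change r ≤ s; omega),
            flagFace_succ_of_le (by change k ≤ s; omega)]
          exact (subcubeFace_congr (hw'.trans (initialSet_mono π (by omega)))).symm
        · rw [flagFace_of_le le_rfl]
          exact hx
      · change 4 ≤ (initialSet π r).card at h4
        obtain ⟨r, rfl⟩ : ∃ t, r = t + 1 := ⟨r - 1, by omega⟩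
        obtain ⟨π', h1, h2⟩ := exists_initialSet_eq_erase π (by omega) hj
        refine finish ⟨w', π', 3, le_rfl, hd⟩ (fun s hs hs' => ?_) ?_
        · obtain ⟨s, rfl⟩ : ∃ t, s = t + 1 := ⟨s - 1, by omega⟩
          rw [flagFace_succ_of_le (by change 3 ≤ s; omega),
            flagFace_succ_of_le (by change k ≤ s; omega), h1 s (by omega)]
          exact (subcubeFace_congr (hw'.trans (initialSet_mono π (by omega)))).symm
        · rw [flagFace_succ_of_le (by change 3 ≤ r; omega), h2]
          exact hx

lemma exists_flagFace_eq_of_mem {p : FlagData d} {f : Flag (HalfCubeFace d)}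
    (hp : ∀ s ≤ d + 1, flagFace p s ∈ f) {F : HalfCubeFace d} (hF : F ∈ f) :
    ∃ s ≤ d + 1, flagFace p s = F := by
  have hle : height F ≤ ((d + 1 : ℕ) : ℕ∞) := by
    rw [← height_flagFace p le_rfl]
    refine height_mono ?_
    rw [flagFace_succ_of_le p.2.2.2.2, initialSet_eq_univ]
    exact isTop_subcubeFace_univ _ _
  obtain ⟨m, hm⟩ := ENat.ne_top_iff_exists.1 (height_lt_top F).ne
  rw [← hm] at hle
  have hle' : m ≤ d + 1 := by exact_mod_cast hle
  exact ⟨m, hle', eq_of_mem_flag_of_height_eq f (hp m hle') hF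
    ((height_flagFace p hle').trans hm)⟩

lemma flagFace_injOn (p : FlagData d) : Set.InjOn (flagFace p) (Set.Iic (d + 1)) := by
  intro r hr s hs h
  have := congrArg height h
  rw [height_flagFace p hr, height_flagFace p hs] at this
  exact_mod_cast this

theorem isComplex_halfCubeFace (hd : 3 ≤ d) : IsComplex (d - 1) (HalfCubeFace d) where
  finite := inferInstance
  exists_bot := ⟨_, isBot_simplexFace_empty ⟨{⟨0, by omega⟩}, by simp⟩⟩
  exists_top := ⟨_, isTop_subcubeFace_univ ⟨{⟨0, by omega⟩}, by simp⟩⟩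
  ranked _ _ h := height_eq_of_covBy (by omega) h
  flag_length f := by
    obtain ⟨p, hp⟩ := exists_flagData hd f
    have : (f : Set (HalfCubeFace d)) = flagFace p '' Set.Iic (d + 1) := by
      ext F
      constructor
      · exact fun hF => exists_flagFace_eq_of_mem hp hF
      · rintro ⟨s, hs, rfl⟩
        exact hp s hs
    rw [this, (flagFace_injOn p).ncard_image]
    simp [Set.ncard_eq_toFinset_card']
    omega
  diamond _ _ hFG h := ncard_Ioo_eq_two (by omega) hFG h

lemma flag_eq_of_flagFace_mem {p : FlagData d} {f g : Flag (HalfCubeFace d)}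
    (hf : ∀ s ≤ d + 1, flagFace p s ∈ f) (hg : ∀ s ≤ d + 1, flagFace p s ∈ g) : f = g := by
  refine SetLike.ext fun F => ⟨fun hF => ?_, fun hF => ?_⟩
  · obtain ⟨s, hs, rfl⟩ := exists_flagFace_eq_of_mem hf hF
    exact hg s hs
  · obtain ⟨s, hs, rfl⟩ := exists_flagFace_eq_of_mem hg hF
    exact hf s hs

lemma exists_flag_flagFace_mem (p : FlagData d) :
    ∃ f : Flag (HalfCubeFace d), ∀ s ≤ d + 1, flagFace p s ∈ f := by
  have hchain : IsChain (· ≤ ·) (Set.range (flagFace p)) :=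
    Monotone.isChain_range fun _ _ h => flagFace_le_flagFace p h
  obtain ⟨f, hf⟩ := hchain.exists_subset_flag
  exact ⟨f, fun s _ => hf ⟨s, rfl⟩⟩

/-- The face is one of the simplices `simplexFace w I`. For a face of height at least five this
means that it is a simplex; among the tetrahedra there are also the half-cubes in three
directions, which are not meant. -/
def IsSimplexFace (F : HalfCubeFace d) : Prop := ∃ w I, F = simplexFace w I

lemma isSimplexFace_flagFace {p : FlagData d} {r : ℕ} (hr : r ≤ d + 1) :
    IsSimplexFace (flagFace p r) ↔ r ≤ p.2.2.1 := by
  have h3 := p.2.2.2.1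
  constructor
  · rintro ⟨w, I, h⟩
    by_contra! hlt
    obtain ⟨r, rfl⟩ : ∃ s, r = s + 1 := ⟨r - 1, by omega⟩
    rw [flagFace_succ_of_le (by omega)] at h
    exact not_subcubeFace_le_simplexFace
      (by rw [card_initialSet _ (by omega)]; omega) h.le
  · exact fun h => ⟨_, _, flagFace_of_le h⟩

lemma flagFace_eq_of_mem {p q : FlagData d} {f : Flag (HalfCubeFace d)} {s : ℕ} (hs : s ≤ d + 1)
    (hp : flagFace p s ∈ f) (hq : flagFace q s ∈ f) : flagFace p s = flagFace q s :=
  eq_of_mem_flag_of_height_eq f hp hq ((height_flagFace p hs).trans (height_flagFace q hs).symm)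

/-- The data of a flag are unique: a simplex with at least three vertices determines `w`, and
the initial sets determine `π`. -/
lemma flagData_ext {p q : FlagData d} (h : ∀ s ≤ d + 1, flagFace p s = flagFace q s) : p = q := by
  obtain ⟨w, π, k, hk3, hkd⟩ := p
  obtain ⟨w', π', k', hk3', hkd'⟩ := q
  have hkk (s : ℕ) (hs : s ≤ d + 1) : s ≤ k ↔ s ≤ k' := by
    have h1 := isSimplexFace_flagFace (p := ⟨w, π, k, hk3, hkd⟩) hs
    rw [h s hs, isSimplexFace_flagFace hs] at h1
    exact h1.symm
  obtain rfl : k = k' := le_antisymm ((hkk k (by omega)).1 le_rfl) ((hkk k' (by omega)).2 le_rfl)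
  obtain rfl : w = w' := by
    have h1 := h k (by omega)
    rw [flagFace_of_le le_rfl, flagFace_of_le le_rfl] at h1
    exact eq_of_simplexFace_le (by rw [card_initialSet _ hkd]; exact hk3) h1.le
  have hinit (s : ℕ) (hs : s ≤ d) : initialSet π s = initialSet π' s := by
    by_cases hsk : s ≤ k
    · have h1 := h s (by omega)
      rw [flagFace_of_le hsk, flagFace_of_le hsk] at h1
      exact simplexFace_injective w h1
    · have h1 := h (s + 1) (by omega)
      rw [flagFace_succ_of_le (by change k ≤ s; omega),
        flagFace_succ_of_le (by change k ≤ s; omega)] at h1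
      have hs3 : 3 ≤ s := by omega
      have hc := card_initialSet π hs
      have hc' := card_initialSet π' hs
      exact (of_subcubeFace_le_subcubeFace (hc.symm ▸ hs3) h1.le).1.antisymm
        (of_subcubeFace_le_subcubeFace (hc'.symm ▸ hs3) h1.ge).1
  obtain rfl : π = π' := by
    rw [← Equiv.symm_bijective.injective.eq_iff]
    refine Equiv.ext fun x => Fin.ext ?_
    have hx (s : ℕ) (hs : s ≤ d) : (π.symm x).val < s ↔ (π'.symm x).val < s := by
      rw [← mem_initialSet, ← mem_initialSet, hinit s hs]
    have h1 := (hx _ (π.symm x).isLt).1 (Nat.lt_succ_self _)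
    have h2 := (hx _ (π'.symm x).isLt).2 (Nat.lt_succ_self _)
    omega
  rfl

lemma card_oddSet (hd : 0 < d) : Nat.card (OddSet d) = 2 ^ (d - 1) := by
  let i : Fin d := ⟨0, hd⟩
  -- changing one coordinate exchanges the odd and the even sets
  let e : {w : Finset (Fin d) // Odd w.card} ≃ {w : Finset (Fin d) // ¬ Odd w.card} :=
    (Function.Involutive.toPerm (fun w : Finset (Fin d) => w ∆ {i})
      fun w => symmDiff_symmDiff_cancel_right _ _).subtypeEquiv fun w => by
        change _ ↔ ¬ Odd (w ∆ {i}).card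
        rw [Nat.not_odd_iff_even, even_card_symmDiff, ← Nat.not_even_iff_odd]
        simp
  have h := Nat.card_congr (Equiv.sumCompl fun w : Finset (Fin d) => Odd w.card)
  rw [Nat.card_sum, ← Nat.card_congr e, Nat.card_eq_fintype_card (α := Finset (Fin d)),
    Fintype.card_finset, Fintype.card_fin] at h
  have hpow : 2 ^ d = 2 ^ (d - 1) * 2 := by rw [← pow_succ, Nat.sub_add_cancel hd]
  change Nat.card (OddSet d) + Nat.card (OddSet d) = 2 ^ d at h
  omega

theorem card_flag_halfCubeFace (hd : 3 ≤ d) :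
    Nat.card (Flag (HalfCubeFace d)) = d.factorial * 2 ^ (d - 1) * (d - 2) := by
  choose F hF using exists_flag_flagFace_mem (d := d)
  have hbij : Function.Bijective F := by
    constructor
    · intro p q h
      exact flagData_ext fun s hs => flagFace_eq_of_mem hs (hF p s hs) (h ▸ hF q s hs)
    · intro f
      obtain ⟨p, hp⟩ := exists_flagData hd f
      exact ⟨p, flag_eq_of_flagFace_mem (hF p) hp⟩
  rw [← Nat.card_eq_of_bijective F hbij, Nat.card_prod, Nat.card_prod, card_oddSet (by omega),
    Nat.card_eq_fintype_card, Fintype.card_perm, Fintype.card_fin]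
  have : Nat.card (Set.Icc 3 d) = d - 2 := by
    simp
  rw [this]
  ring

end Flags

/-! ### The simplex rank of a flag under the translation -/

section SimplexRank

variable {d : ℕ}

open Order

/-- The simplex rank of the flag, that is, the largest height of a face `simplexFace w I` in it, is
`k`. -/
def HasSimplexRank (k : ℕ) (f : Flag (HalfCubeFace d)) : Prop :=
  ∃ p : FlagData d, p.2.2.1 = k ∧ ∀ s ≤ d + 1, flagFace p s ∈ f

lemma exists_hasSimplexRank (hd : 3 ≤ d) (f : Flag (HalfCubeFace d)) :
    ∃ k, 3 ≤ k ∧ k ≤ d ∧ HasSimplexRank k f := by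
  obtain ⟨p, hp⟩ := exists_flagData hd f
  exact ⟨p.2.2.1, p.2.2.2.1, p.2.2.2.2, p, rfl, hp⟩

lemma HasSimplexRank.le {k : ℕ} {f : Flag (HalfCubeFace d)} (h : HasSimplexRank k f) :
    3 ≤ k ∧ k ≤ d := by
  obtain ⟨p, rfl, -⟩ := h
  exact ⟨p.2.2.2.1, p.2.2.2.2⟩

lemma HasSimplexRank.isSimplexFace_iff {k : ℕ} {f : Flag (HalfCubeFace d)}
    (h : HasSimplexRank k f) {F : HalfCubeFace d} (hF : F ∈ f) {s : ℕ} (hs : s ≤ d + 1)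
    (hFs : height F = s) : IsSimplexFace F ↔ s ≤ k := by
  obtain ⟨p, rfl, hp⟩ := h
  rw [eq_of_mem_flag_of_height_eq f hF (hp s hs) (hFs.trans (height_flagFace p hs).symm)]
  exact isSimplexFace_flagFace hs

/-- The effect of `σ_i` on the simplex rank `k`: only `σ_k` and `σ_{k+1}` change it. They exchange
the two faces between a simplex on `I` and the subcube in the directions of `insert a I`. -/
lemma HasSimplexRank.of_flagAdj (hd : 3 ≤ d) {k i : ℕ} {f g : Flag (HalfCubeFace d)}
    (hf : HasSimplexRank k f) (hi : 1 ≤ i) (hi' : i ≤ d) (hfg : FlagAdj i f g) :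
    HasSimplexRank (if i = k then max 3 (k - 1) else if i = k + 1 then k + 1 else k) g := by
  obtain ⟨p, rfl, hp⟩ := hf
  obtain ⟨q, hq⟩ := exists_flagData hd g
  refine ⟨q, ?_, hq⟩
  have heq (s : ℕ) (hs : s ≤ d + 1) (hsi : s ≠ i) : flagFace p s = flagFace q s := by
    refine flagFace_eq_of_mem hs ((hfg.2 _ ?_).1 (hp s hs)) (hq s hs)
    rw [height_flagFace p hs]
    exact_mod_cast hsi
  have hne : flagFace p i ≠ flagFace q i := fun h =>
    hfg.1 (flag_eq_of_agree hfg.2 (hp i (by omega)) (h ▸ hq i (by omega))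
      (height_flagFace p (by omega)))
  have hiff (s : ℕ) (hs : s ≤ d + 1) (hsi : s ≠ i) : s ≤ p.2.2.1 ↔ s ≤ q.2.2.1 := by
    rw [← isSimplexFace_flagFace hs, ← isSimplexFace_flagFace hs, heq s hs hsi]
  have hIoo : flagFace q i ∈ Set.Ioo (flagFace p (i - 1)) (flagFace p (i + 1)) := by
    rw [heq (i - 1) (by omega) (by omega), heq (i + 1) (by omega) (by omega)]
    refine ⟨lt_of_mem_flag_of_height_lt g (hq _ (by omega)) (hq _ (by omega)) ?_,
      lt_of_mem_flag_of_height_lt g (hq _ (by omega)) (hq _ (by omega)) ?_⟩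
    · rw [height_flagFace q (by omega), height_flagFace q (by omega)]
      exact_mod_cast (by omega : i - 1 < i)
    · rw [height_flagFace q (by omega), height_flagFace q (by omega)]
      exact_mod_cast Nat.lt_succ_self i
  have hp3 := p.2.2.2.1
  have hpd := p.2.2.2.2
  have hq3 := q.2.2.2.1
  have hqd := q.2.2.2.2
  split_ifs with h1 h2
  · have h3 := hiff (i - 1) (by omega) (by omega)
    have h4 := hiff (i + 1) (by omega) (by omega)
    suffices p.2.2.1 ≠ 3 → q.2.2.1 ≠ p.2.2.1 by omega
    intro h5 h6
    rw [flagFace_of_le (by omega : i - 1 ≤ p.2.2.1), flagFace_succ_of_le h1.ge] at hIoo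
    obtain ⟨j, rfl⟩ : ∃ j, i = j + 1 := ⟨i - 1, by omega⟩
    rw [Nat.add_sub_cancel, initialSet_succ _ (by omega)] at hIoo
    have hc := card_initialSet p.2.1 (r := j) (by omega)
    rcases eq_of_mem_Ioo_simplexFace_subcubeFace (notMem_initialSet _ _) (by omega) hIoo with
      h | ⟨h, h'⟩ | ⟨h, -⟩
    · rw [← initialSet_succ, ← flagFace_of_le h1.le] at h
      exact hne h.symm
    · have h7 := (isSimplexFace_flagFace (p := q) (r := j + 1) (by omega)).2 (by omega)
      rw [h'] at h7
      obtain ⟨w, I, h7⟩ := h7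
      exact not_subcubeFace_le_simplexFace h h7.le
    · omega
  · have h3 := hiff (i - 1) (by omega) (by omega)
    have h4 := hiff (i + 1) (by omega) (by omega)
    suffices q.2.2.1 ≠ p.2.2.1 by omega
    intro h6
    subst h2
    rw [Nat.add_sub_cancel, flagFace_of_le le_rfl, flagFace_succ_of_le (Nat.le_succ _),
      initialSet_succ _ (by omega)] at hIoo
    have hc := card_initialSet p.2.1 hpd
    rcases eq_of_mem_Ioo_simplexFace_subcubeFace (notMem_initialSet _ _) (by omega) hIoo with
      h | ⟨-, h⟩ | ⟨h, -⟩
    · have h7 := (isSimplexFace_flagFace (p := q) (r := p.2.2.1 + 1) (by omega)).1 ⟨_, _, h⟩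
      omega
    · rw [← flagFace_succ_of_le le_rfl] at h
      exact hne h.symm
    · omega
  · have h3 := hiff p.2.2.1 (by omega) (by omega)
    have h4 := hiff (p.2.2.1 + 1) (by omega) (by omega)
    omega

lemma HasSimplexRank.of_partial_translation (hd : 3 ≤ d) {k : ℕ} {f : Flag (HalfCubeFace d)}
    (hf : HasSimplexRank k f) {j : ℕ} (hj : j ≤ d) :
    HasSimplexRank (if k = 3 then max 3 j else if j < k then k else k - 1) (translation j f) := by
  have hα := isComplex_halfCubeFace hd
  have hk := hf.le
  induction j with
  | zero =>
    convert hf using 1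
    · split_ifs <;> omega
    · rfl
  | succ j ih =>
    convert (ih (by omega)).of_flagAdj hd (by omega) hj
      (hα.flagAdj_sigma (translation j f) (i := j + 1) (by omega) (by omega)) using 1
    · split_ifs <;> omega
    · rfl

/-- The translation lowers the simplex rank by one, and it turns the rank three into `d`. -/
lemma HasSimplexRank.of_translation (hd : 3 ≤ d) {k : ℕ} {f : Flag (HalfCubeFace d)}
    (hf : HasSimplexRank k f) :
    HasSimplexRank (if k = 3 then d else k - 1) (translation (d - 1 + 1) f) := by
  have hk := hf.le
  convert hf.of_partial_translation hd (j := d - 1 + 1) (by omega) using 1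
  split_ifs <;> omega

lemma HasSimplexRank.iterate (hd : 3 ≤ d) {k m : ℕ} {f : Flag (HalfCubeFace d)}
    (hf : HasSimplexRank k f) (hm : m + 3 ≤ k) :
    HasSimplexRank (k - m) ((translation (d - 1 + 1))^[m] f) := by
  induction m with
  | zero => exact hf
  | succ m ih =>
    rw [Function.iterate_succ_apply']
    convert (ih (by omega)).of_translation hd using 1
    rw [if_neg (by omega)]
    omega

/-- Iterating the translation, a flag runs through all simplex ranks. -/
lemma HasSimplexRank.exists_iterate (hd : 3 ≤ d) {k k' : ℕ} {f : Flag (HalfCubeFace d)}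
    (hf : HasSimplexRank k f) (hk' : 3 ≤ k') (hk'd : k' ≤ d) :
    ∃ m, HasSimplexRank k' ((translation (d - 1 + 1))^[m] f) := by
  have hk := hf.le
  have h1 := (hf.iterate hd (m := k - 3) (by omega)).of_translation hd
  rw [if_pos (by omega), ← Function.iterate_succ_apply' (translation (d - 1 + 1))] at h1
  have h2 := h1.iterate hd (m := d - k') (by omega)
  rw [← Function.iterate_add_apply, Nat.sub_sub_self hk'd] at h2
  exact ⟨_, h2⟩

end SimplexRank

/-! ### Automorphisms of the poset of faces -/

section Automorphisms

variable {d : ℕ}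

open Order

/-- A permutation of the vertices of the cube that maps vertex sets of faces to vertex sets of
faces induces an automorphism of the poset of faces. -/
lemma exists_orderIso (φ : Equiv.Perm (Finset (Fin d)))
    (h : ∀ F : HalfCubeFace d, ∃ G : HalfCubeFace d, verts G = φ '' verts F) :
    ∃ e : HalfCubeFace d ≃o HalfCubeFace d, ∀ F, verts (e F) = φ '' verts F := by
  choose Φ hΦ using h
  have hinj : Function.Injective Φ := fun F G hFG => verts_injective <|
    φ.injective.image_injective (by rw [← hΦ, ← hΦ, hFG])
  refine ⟨⟨Equiv.ofBijective Φ (Finite.injective_iff_bijective.1 hinj), ?_⟩, hΦ⟩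
  intro F G
  rw [le_iff_verts_subset, le_iff_verts_subset]
  change verts (Φ F) ⊆ verts (Φ G) ↔ _
  rw [hΦ, hΦ, Set.image_subset_image_iff φ.injective]

/-- The symmetries of the cube that preserve the half-cube, given by a permutation `τ` of the
coordinates and a set `D` of coordinates that are reflected. -/
lemma exists_orderIso_of_perm (hd : 0 < d) (τ : Equiv.Perm (Fin d)) {D : Finset (Fin d)}
    (hD : Even D.card) :
    ∃ e : HalfCubeFace d ≃o HalfCubeFace d, ∀ w w' : OddSet d, w'.1 = w.1.map τ.toEmbedding ∆ D →
      ∀ I, e (simplexFace w I) = simplexFace w' (I.map τ.toEmbedding) ∧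
        e (subcubeFace w I) = subcubeFace w' (I.map τ.toEmbedding) := by
  let φ : Equiv.Perm (Finset (Fin d)) :=
    τ.finsetCongr.trans (Function.Involutive.toPerm (fun S => S ∆ D)
      fun S => symmDiff_symmDiff_cancel_right _ _)
  have hφ (S : Finset (Fin d)) : φ S = S.map τ.toEmbedding ∆ D := rfl
  have hdiff (w w' : Finset (Fin d)) (hw : w' = w.map τ.toEmbedding ∆ D) (S : Finset (Fin d)) :
      w' ∆ φ S = (w ∆ S).map τ.toEmbedding := by
    ext x
    simp only [hφ, hw, Finset.mem_symmDiff, Finset.mem_map_equiv]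
    tauto
  have hcard (S : Finset (Fin d)) : Even (φ S).card ↔ Even S.card := by
    rw [hφ, even_card_symmDiff, Finset.card_map]
    simp [hD]
  have himage (A B : Set (Finset (Fin d))) (h : ∀ S, φ S ∈ B ↔ S ∈ A) : φ '' A = B := by
    ext S
    constructor
    · rintro ⟨S, hS, rfl⟩
      exact (h S).2 hS
    · intro hS
      exact ⟨φ.symm S, (h _).1 (by simpa), by simp⟩
  have hsimplex (w w' : OddSet d) (hw : w'.1 = w.1.map τ.toEmbedding ∆ D) (I : Finset (Fin d)) :
      φ '' simplexSet w.1 I = simplexSet w'.1 (I.map τ.toEmbedding) := by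
    refine himage _ _ fun S => ?_
    have key (u S : Finset (Fin d)) (i : Fin d) : S = u ∆ {i} ↔ u ∆ S = {i} := by
      rw [← symmDiff_right_inj (a := u) (b := S), symmDiff_symmDiff_cancel_left]
    simp only [simplexSet, Set.mem_ofPred_eq, key, hdiff _ _ hw]
    constructor
    · rintro ⟨j, hj, h⟩
      obtain ⟨i, hi, rfl⟩ := Finset.mem_map.1 hj
      refine ⟨i, hi, ?_⟩
      rw [← Finset.map_singleton] at h
      exact Finset.map_injective _ h
    · rintro ⟨i, hi, h⟩
      exact ⟨_, Finset.mem_map_of_mem _ hi, by rw [h, Finset.map_singleton]⟩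
  have hsubcube (w w' : OddSet d) (hw : w'.1 = w.1.map τ.toEmbedding ∆ D) (J : Finset (Fin d)) :
      φ '' subcubeSet w.1 J = subcubeSet w'.1 (J.map τ.toEmbedding) := by
    refine himage _ _ fun S => ?_
    simp only [subcubeSet, Set.mem_ofPred_eq, hcard, hdiff _ _ hw, Finset.map_subset_map]
  have hw' (w : OddSet d) : ∃ w' : OddSet d, w'.1 = w.1.map τ.toEmbedding ∆ D := by
    refine ⟨⟨φ w.1, ?_⟩, rfl⟩
    rw [← Nat.not_even_iff_odd, hcard]
    exact Nat.not_even_iff_odd.2 w.2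
  obtain ⟨e, he⟩ := exists_orderIso φ fun F => by
    rcases eq_simplexFace_or_subcubeFace hd F with ⟨w, I, rfl⟩ | ⟨w, J, -, rfl⟩
    · obtain ⟨w', h⟩ := hw' w
      exact ⟨simplexFace w' _, by rw [verts_simplexFace, verts_simplexFace, hsimplex w w' h]⟩
    · obtain ⟨w', h⟩ := hw' w
      exact ⟨subcubeFace w' _, by rw [verts_subcubeFace, verts_subcubeFace, hsubcube w w' h]⟩
  refine ⟨e, fun w w' h I => ⟨verts_injective ?_, verts_injective ?_⟩⟩
  · rw [he, verts_simplexFace, verts_simplexFace, hsimplex w w' h]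
  · rw [he, verts_subcubeFace, verts_subcubeFace, hsubcube w w' h]

lemma exists_smul_eq_of_hasSimplexRank (hd : 0 < d) {k : ℕ} {f g : Flag (HalfCubeFace d)}
    (hf : HasSimplexRank k f) (hg : HasSimplexRank k g) :
    ∃ e : HalfCubeFace d ≃o HalfCubeFace d, f = e • g := by
  obtain ⟨q, hqk, hq⟩ := hf
  obtain ⟨p, hpk, hp⟩ := hg
  have hD : Even (p.1.1.map (q.2.1 * p.2.1⁻¹).toEmbedding ∆ q.1.1).card := by
    rw [even_card_symmDiff, Finset.card_map]
    simp [Nat.not_even_iff_odd.2 p.1.2, Nat.not_even_iff_odd.2 q.1.2]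
  obtain ⟨e, he⟩ := exists_orderIso_of_perm hd (q.2.1 * p.2.1⁻¹) hD
  have he' := he p.1 q.1 (symmDiff_symmDiff_cancel_left _ _).symm
  have hface (s : ℕ) : e (flagFace p s) = flagFace q s := by
    rw [flagFace, flagFace, hpk, hqk]
    split_ifs
    · rw [(he' _).1, map_initialSet, inv_mul_cancel_right]
    · rw [(he' _).2, map_initialSet, inv_mul_cancel_right]
  refine ⟨e, flag_eq_of_flagFace_mem hq fun s hs => ?_⟩
  rw [← hface, smul_mem_smul_flag]
  exact hp s hs

/-- For `d ≥ 5` the faces `simplexFace w I` are recognized in the poset: they lie in a simplex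
facet, and a simplex facet differs from a half-cube in that any two of its vertices are joined by
an edge. -/
lemma isSimplexFace_iff_exists (hd : 5 ≤ d) (F : HalfCubeFace d) :
    IsSimplexFace F ↔ ∃ G, F ≤ G ∧ height G = d ∧ ∀ x y : HalfCubeFace d, x ≤ G → y ≤ G →
      height x = 1 → height y = 1 → ∃ z, x ≤ z ∧ y ≤ z ∧ height z ≤ 2 := by
  constructor
  · rintro ⟨w, I, rfl⟩
    refine ⟨simplexFace w Finset.univ, by simp, by simp, fun x y hx hy hx1 hy1 => ?_⟩
    obtain ⟨A, -, rfl⟩ := exists_eq_of_le_simplexFace hx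
    obtain ⟨B, -, rfl⟩ := exists_eq_of_le_simplexFace hy
    rw [height_simplexFace] at hx1 hy1
    norm_cast at hx1 hy1
    refine ⟨simplexFace w (A ∪ B), by simp, by simp, ?_⟩
    rw [height_simplexFace]
    exact_mod_cast (Finset.card_union_le A B).trans (by omega)
  · rintro ⟨G, hFG, hG, hjoin⟩
    rcases eq_simplexFace_or_subcubeFace_of_height (by omega) hG with
      ⟨w, I, -, rfl⟩ | ⟨w, J, hJ3, hJ, rfl⟩
    · obtain ⟨I', -, rfl⟩ := exists_eq_of_le_simplexFace hFG
      exact ⟨w, I', rfl⟩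
    exfalso
    -- two vertices of the half-cube that differ in four coordinates are not joined by an edge
    obtain ⟨T, hTJ, hT⟩ := Finset.exists_subset_card_eq (by omega : 4 ≤ J.card)
    obtain ⟨j, hj⟩ : T.Nonempty := Finset.card_pos.1 (by omega)
    have hw' : Odd (w.1 ∆ T).card := by
      rw [← Nat.not_even_iff_odd, even_card_symmDiff, hT]
      simp only [Nat.not_even_iff_odd.2 w.2, false_iff]
      decide
    obtain ⟨z, hxz, hyz, hz⟩ := hjoin (simplexFace w {j}) (simplexFace ⟨w.1 ∆ T, hw'⟩ {j})
      (simplexFace_le_subcubeFace (by simpa using hTJ hj) (by simp))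
      (simplexFace_le_subcubeFace (by simpa using hTJ hj) (by simpa)) (by simp) (by simp)
    obtain ⟨m, hm⟩ := ENat.ne_top_iff_exists.1 (height_lt_top z).ne
    rw [← hm] at hz
    norm_cast at hz
    rcases eq_simplexFace_or_subcubeFace_of_height (by omega) hm.symm with
      ⟨u, I, hI, rfl⟩ | ⟨u, J', hJ', hJ'm, -⟩
    · rw [le_iff_verts_subset, verts_simplexFace, verts_simplexFace] at hxz hyz
      obtain ⟨a, ha, h1⟩ := hxz (mem_simplexSet_iff.2 (Finset.mem_singleton_self j))
      obtain ⟨b, hb, h2⟩ := hyz (mem_simplexSet_iff.2 (Finset.mem_singleton_self j))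
      have h3 : T = {a} ∆ {b} := by
        have h4 : (w.1 ∆ {j}) ∆ ((w.1 ∆ T) ∆ {j}) = T := by
          rw [symmDiff_symmDiff_symmDiff_comm, symmDiff_symmDiff_cancel_left, symmDiff_self,
            symmDiff_bot]
        change w.1 ∆ T ∆ {j} = _ at h2
        rw [h1, h2, symmDiff_symmDiff_symmDiff_comm, symmDiff_self, bot_symmDiff] at h4
        exact h4.symm
      have h5 : T.card ≤ 2 := by
        rw [h3]
        exact (Finset.card_le_card symmDiff_le_sup).trans
          ((Finset.card_union_le _ _).trans (by simp))
      omega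
    · omega

lemma isSimplexFace_apply_iff (hd : 5 ≤ d) (e : HalfCubeFace d ≃o HalfCubeFace d)
    (F : HalfCubeFace d) : IsSimplexFace (e F) ↔ IsSimplexFace F := by
  suffices H : ∀ (e : HalfCubeFace d ≃o HalfCubeFace d) (F : HalfCubeFace d),
      IsSimplexFace F → IsSimplexFace (e F) from
    ⟨fun h => by simpa using H e.symm _ h, H e F⟩
  intro e F h
  rw [isSimplexFace_iff_exists hd] at h ⊢
  obtain ⟨G, hFG, hG, hjoin⟩ := h
  refine ⟨e G, e.monotone hFG, by rwa [height_orderIso], fun x y hx hy hx1 hy1 => ?_⟩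
  obtain ⟨z, hxz, hyz, hz⟩ := hjoin (e.symm x) (e.symm y) (e.symm_apply_le.2 hx)
    (e.symm_apply_le.2 hy) (by rwa [height_orderIso]) (by rwa [height_orderIso])
  exact ⟨e z, e.symm_apply_le.1 hxz, e.symm_apply_le.1 hyz, by rwa [height_orderIso]⟩

lemma HasSimplexRank.eq_of_smul (hd : 5 ≤ d) {k k' : ℕ} {f : Flag (HalfCubeFace d)}
    (e : HalfCubeFace d ≃o HalfCubeFace d) (hf : HasSimplexRank k f)
    (hef : HasSimplexRank k' (e • f)) : k = k' := by
  obtain ⟨p, rfl, hp⟩ := hf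
  have hpd := p.2.2.2.2
  have hk' := hef.le
  have key (s : ℕ) (hs : s ≤ d + 1) : s ≤ p.2.2.1 ↔ s ≤ k' := by
    rw [← isSimplexFace_flagFace hs, ← isSimplexFace_apply_iff hd e]
    exact hef.isSimplexFace_iff (smul_mem_smul_flag.2 (hp s hs)) hs
      (by rw [height_orderIso, height_flagFace p hs])
  exact le_antisymm ((key _ (by omega)).1 le_rfl) ((key _ (by omega)).2 le_rfl)

/-- The half-`4`-cube is a cross polytope. The reflection that exchanges the two opposite vertices
`∅` and `univ` and fixes the other six is not a symmetry of the cube. -/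
lemma exists_orderIso_swap : ∃ e : HalfCubeFace 4 ≃o HalfCubeFace 4,
    ∀ F, verts (e F) = Equiv.swap ∅ Finset.univ '' verts F := by
  have huniv : (Finset.univ : Finset (Fin 4)) ≠ ∅ := by decide
  refine exists_orderIso _ fun F => ?_
  rcases verts_eq_empty_or_maximizers F with h | ⟨c, hc⟩
  · exact ⟨F, by simp [h]⟩
  -- composing the functional `c` with the reflection in the hyperplane `∑ x i = 2`
  obtain ⟨G, hG⟩ := exists_verts_eq_maximizers fun i => c i - (∑ j, c j) / 2
  refine ⟨G, ?_⟩
  rw [hG, hc]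
  set φ := Equiv.swap (∅ : Finset (Fin 4)) Finset.univ with hφ
  have hφφ (S : Finset (Fin 4)) : φ (φ S) = S := 
    DFunLike.congr_fun (Equiv.swap_swap ∅ Finset.univ) S
  have heven (S : Finset (Fin 4)) (hS : Even S.card) : Even (φ S).card := by
    rw [hφ, Equiv.swap_apply_def]
    split_ifs
    · decide
    · decide
    · exact hS
  have key (S : Finset (Fin 4)) (hS : Even S.card) :
      ∑ i ∈ S, (c i - (∑ j, c j) / 2) = ∑ i ∈ φ S, c i - ∑ j, c j := by
    rw [Finset.sum_sub_distrib, Finset.sum_const, nsmul_eq_mul, hφ, Equiv.swap_apply_def]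
    split_ifs with h1 h2
    · simp [h1]
    · simp [h2]
      ring
    · have h3 : S.card ≤ 4 := S.card_le_univ.trans (by simp)
      have h4 : S.card ≠ 0 := fun h => h1 (Finset.card_eq_zero.1 h)
      have h5 : S.card ≠ 4 := fun h => h2 ((Finset.card_eq_iff_eq_univ S).1 (by simpa))
      have h6 : S.card = 2 := by
        rw [Nat.even_iff] at hS
        omega
      rw [h6]
      push_cast
      ring
  ext S
  rw [Equiv.image_eq_preimage_symm]
  change _ ↔ φ S ∈ maximizers c
  constructor
  · rintro ⟨hS, h⟩
    refine ⟨heven S hS, fun S' hS' => ?_⟩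
    have := h (φ S') (heven S' hS')
    rw [key _ (heven S' hS'), key _ hS, hφφ] at this
    linarith
  · rintro ⟨hS, h⟩
    have hS' := heven _ hS
    rw [hφφ] at hS'
    refine ⟨hS', fun S' hS'' => ?_⟩
    rw [key _ hS'', key _ hS']
    linarith [h _ (heven S' hS'')]

/-- The additional reflection maps the simplex facet at `{0}`, which contains the vertex `∅`, to
the facet on which the coordinate `0` is one. -/
lemma exists_smul_hasSimplexRank_three : ∃ (f : Flag (HalfCubeFace 4))
    (e : HalfCubeFace 4 ≃o HalfCubeFace 4), HasSimplexRank 4 f ∧ HasSimplexRank 3 (e • f) := by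
  obtain ⟨e, he⟩ := exists_orderIso_swap
  let w : OddSet 4 := ⟨{0}, by simp⟩
  let p : FlagData 4 := ⟨w, 1, 4, by simp⟩
  obtain ⟨f, hf⟩ := exists_flag_flagFace_mem p
  have hfr : HasSimplexRank 4 f := ⟨p, rfl, hf⟩
  refine ⟨f, e, hfr, ?_⟩
  obtain ⟨k, hk3, hk4, hk⟩ := exists_hasSimplexRank (by omega) (e • f)
  have h4 : flagFace p 4 = simplexFace w Finset.univ := by
    rw [flagFace_of_le le_rfl, initialSet_eq_univ]
  have hiff := hk.isSimplexFace_iff (smul_mem_smul_flag.2 (hf 4 (by omega))) (s := 4) (by omega)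
    (by rw [height_orderIso, height_flagFace p (by omega)])
  have himage : e (flagFace p 4) = subcubeFace w {1, 2, 3} := by
    apply verts_injective
    rw [he, h4, verts_simplexFace, verts_subcubeFace]
    ext S
    rw [Equiv.image_eq_preimage_symm]
    simp only [Set.mem_preimage, Equiv.symm_swap, simplexSet, subcubeSet, Set.mem_ofPred_eq]
    revert S
    decide
  have hnot : ¬ IsSimplexFace (e (flagFace p 4)) := by
    rw [himage]
    rintro ⟨u, I, h⟩
    exact not_subcubeFace_le_simplexFace (by decide) h.le
  rw [hiff] at hnot
  obtain rfl : k = 3 := by omega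
  exact hk

lemma exists_smul_eq_of_le_four (hd : 3 ≤ d) (hd4 : d ≤ 4) (f g : Flag (HalfCubeFace d)) :
    ∃ e : HalfCubeFace d ≃o HalfCubeFace d, f = e • g := by
  obtain ⟨k, hk3, hkd, hk⟩ := exists_hasSimplexRank hd f
  obtain ⟨k', hk3', hkd', hk'⟩ := exists_hasSimplexRank hd g
  by_cases hkk : k = k'
  · subst hkk
    exact exists_smul_eq_of_hasSimplexRank (by omega) hk hk'
  obtain rfl : d = 4 := by omega
  obtain ⟨u, e, hu, heu⟩ := exists_smul_hasSimplexRank_three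
  rcases (by omega : k = 3 ∧ k' = 4 ∨ k = 4 ∧ k' = 3) with ⟨rfl, rfl⟩ | ⟨rfl, rfl⟩
  · obtain ⟨a, ha⟩ := exists_smul_eq_of_hasSimplexRank (by omega) hk heu
    obtain ⟨b, hb⟩ := exists_smul_eq_of_hasSimplexRank (by omega) hu hk'
    exact ⟨a * (e * b), by rw [ha, hb, mul_smul, mul_smul]⟩
  · obtain ⟨a, ha⟩ := exists_smul_eq_of_hasSimplexRank (by omega) hk hu
    obtain ⟨b, hb⟩ := exists_smul_eq_of_hasSimplexRank (by omega) heu hk'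
    exact ⟨a * (e⁻¹ * b), by rw [ha, mul_smul, mul_smul, ← hb, inv_smul_smul]⟩

end Automorphisms

/-! ### Orbits of flags -/

section Orbits

variable {d : ℕ}

lemma exists_flag_hasSimplexRank {k : ℕ} (hk : 3 ≤ k) (hkd : k ≤ d) :
    ∃ f : Flag (HalfCubeFace d), HasSimplexRank k f := by
  obtain ⟨f, hf⟩ := exists_flag_flagFace_mem
    (⟨⟨{⟨0, by omega⟩}, by simp⟩, 1, k, hk, hkd⟩ : FlagData d)
  exact ⟨f, _, rfl, hf⟩

theorem card_flagOrbit_of_le_four (hd : 3 ≤ d) (hd4 : d ≤ 4) :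
    Nat.card (FlagOrbit (HalfCubeFace d)) = 1 := by
  rw [Nat.card_eq_one_iff_unique]
  obtain ⟨f, -⟩ := exists_flag_hasSimplexRank le_rfl hd
  refine ⟨⟨fun o o' => ?_⟩, ⟨flagOrbit f⟩⟩
  obtain ⟨f, rfl⟩ := Quotient.exists_rep o
  obtain ⟨g, rfl⟩ := Quotient.exists_rep o'
  exact flagOrbit_eq_iff.2 (exists_smul_eq_of_le_four hd hd4 f g)

theorem card_flagOrbit_of_five_le (hd : 5 ≤ d) :
    Nat.card (FlagOrbit (HalfCubeFace d)) = d - 2 := by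
  choose F hF using fun k : Set.Icc 3 d => exists_flag_hasSimplexRank k.2.1 k.2.2
  have hbij : Function.Bijective fun k => flagOrbit (F k) := by
    constructor
    · intro k k' h
      obtain ⟨e, he⟩ := flagOrbit_eq_iff.1 h
      exact Subtype.ext ((hF k').eq_of_smul hd e (he ▸ hF k)).symm
    · intro o
      obtain ⟨f, rfl⟩ := Quotient.exists_rep o
      obtain ⟨k, hk3, hkd, hk⟩ := exists_hasSimplexRank (by omega) f
      exact ⟨⟨k, hk3, hkd⟩, flagOrbit_eq_iff.2
        (exists_smul_eq_of_hasSimplexRank (by omega) (hF _) hk)⟩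
  rw [← Nat.card_eq_of_bijective _ hbij]
  simp

lemma exists_iterate_translation_eq_smul (hd : 3 ≤ d) (f g : Flag (HalfCubeFace d)) :
    ∃ (m : ℕ) (e : HalfCubeFace d ≃o HalfCubeFace d),
      (translation (d - 1 + 1))^[m] f = e • g := by
  obtain ⟨k, -, -, hk⟩ := exists_hasSimplexRank hd f
  obtain ⟨k', hk3, hkd, hk'⟩ := exists_hasSimplexRank hd g
  obtain ⟨m, hm⟩ := hk.exists_iterate hd hk3 hkd
  exact ⟨m, exists_smul_eq_of_hasSimplexRank (by omega) hm hk'⟩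

end Orbits

end Zigzag

theorem proposition4p2 (d : ℕ) (hd : 3 ≤ d) :
    -- the faces form a complex of dimension `d - 1`, so that `T = σ_d ⋯ σ_1` is meaningful
    Zigzag.IsComplex (d - 1) (Zigzag.HalfCubeFace d) ∧
    -- the number of flags
    Nat.card (Flag (Zigzag.HalfCubeFace d)) = d.factorial * 2 ^ (d - 1) * (d - 2) ∧
    -- the number of orbits of flags
    (d ≤ 4 → Nat.card (Zigzag.FlagOrbit (Zigzag.HalfCubeFace d)) = 1) ∧
    (5 ≤ d → Nat.card (Zigzag.FlagOrbit (Zigzag.HalfCubeFace d)) = d - 2) ∧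
    -- `T` permutes the orbits of flags in a single cycle
    (∃ τ : Equiv.Perm (Zigzag.FlagOrbit (Zigzag.HalfCubeFace d)),
      (∀ f : Flag (Zigzag.HalfCubeFace d),
        Zigzag.flagOrbit (Zigzag.translation (d - 1 + 1) f) = τ (Zigzag.flagOrbit f)) ∧
      τ.IsCycleOn Set.univ) ∧
    -- every zigzag meets every orbit of flags
    (∀ Z : Set (Flag (Zigzag.HalfCubeFace d)), Zigzag.IsZigzag (d - 1) Z →
      ∀ o : Zigzag.FlagOrbit (Zigzag.HalfCubeFace d), ∃ f ∈ Z, Zigzag.flagOrbit f = o) ∧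
    -- the half-cube is `z`-uniform
    Zigzag.IsZUniform (d - 1) (Zigzag.HalfCubeFace d) := by
  have hα := Zigzag.isComplex_halfCubeFace hd
  have H := Zigzag.exists_iterate_translation_eq_smul hd
  refine ⟨hα, Zigzag.card_flag_halfCubeFace hd, Zigzag.card_flagOrbit_of_le_four hd,
    Zigzag.card_flagOrbit_of_five_le, hα.exists_perm_isCycleOn H, ?_, hα.isZUniform H⟩
  rintro _ ⟨f, rfl⟩ o
  obtain ⟨g, rfl⟩ := Quotient.exists_rep o
  obtain ⟨m, e, h⟩ := H f g
  exact ⟨_, ⟨m, rfl⟩, Zigzag.flagOrbit_eq_iff.2 ⟨e, h⟩⟩
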